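/- Let $\mathcal V$ be the set of functions $V\in C^\infty((0,\infty),\mathbb R)$ such that (i) $V(x)\to+\infty$ as $x\to0^+$; for some $S\in(0,+\infty]$, on $(0,S)$, (ii) $V'<0$ and $V''>0$, and (iii) $V'/V''$ is decreasing; and (iv) the one-sided derivative at $0$ of the continuous extension of $V'/V''$ to $0$ exists and is $<-\tfrac12$. Let $\mathcal V^*$ be the set of $V\in\mathcal V$ such that (v) $V(\lambda x)/V(\lambda)\to1$ as $\lambda\to0^+$, uniformly for $x$ in every interval $[1,M]$. For initial data $\nu=(q,p)\in(\mathbb R^2\setminus\{0\})\times\mathbb R^2$ let $u_\nu$ be the classical solution (with values in $\mathbb R^2\setminus\{0\}$) of $\ddot u=\nabla (V(|u|))$, $(u(0),\dot u(0))=\nu$, and for $\varepsilon>0$ let $u_{\varepsilon,\nu}$ be the solution of $\ddot u=\nabla (V_\varepsilon(|u|))$ with the same data, where $V_\varepsilon(x)=V(\sqrt{x^2+\varepsilon^2})$. For $\bar R\in(0,+\infty]$ let $S(V)$ be the set of $\nu=(q,p)$ with $0<|q|\le\bar R$ for which $u_\nu$ collides, i.e. $u_\nu(t)\to0$ as $t\to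 T_0^-$ for some finite $T_0=T_0(\nu)>0$. For $\nu\in S(V)$ the transmission solution is $u_0(t)=u_\nu(t)$ for $0\le t<T_0$, $u_0(T_0)=0$, and $u_0(t)=-u_\nu(2T_0-t)$ for $T_0<t\le2T_0$. The extended flow $\tilde u_\nu(t)$ is $u_0(t)$, $0\le t\le 2T_0(\nu)$, if $\nu\in S(V)$, and $u_\nu(t)$, for $t\ge0$ in its maximal interval of existence, if $\nu\notin S(V)$, $0<|q|\le\bar R$. Theorem. Let $V\in\mathcal V^*$. There are $S,T\in(0,+\infty]$ such that (ii) and (iii) hold on $(0,S)$ and $V'(x)/V''(x)\le-x/2$ on $(0,T)$. For all such $S,T$ and $\bar R=\min\{T,S\}$, the one-centre problem is strongly regularizable via smoothing of the potential for initial positions in the ball $B_0(\bar R)$, with the transmission solution as limit: (a) for every $\bar\nu\in S(V)$, the solutions $u_{\varepsilon,\nu}$ exist on $[0,2T_0(\bar\nu)]$ for $(\varepsilon,\nu)$ sufficiently close to $(0^+,\bar\nu)$, and converge uniformly on this interval to the transmission solution $u_0$ of $\bar\nu$ as $(\varepsilon,\nu)\to(0^+,\bar\nu)$; (b) the extended flow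 is continuous with respect to the initial data: the map $(\nu,t)\mapsto\tilde u_\nu(t)$ is continuous on its domain, and if $\tilde u_{\bar\nu}$ is defined beyond the time $t\ge0$, then $\tilde u_\nu(t')$ is defined for all $\nu=(q,p)$ with $|q|\le\bar R$ and $t'\ge0$ such that $(\nu,t')$ is sufficiently close to $(\bar\nu,t)$. -/

import Mathlib

open Set Filter Topology
open scoped ContDiff

/-- The configuration plane `ℝ²` with its Euclidean norm. -/
abbrev Plane : Type := EuclideanSpace ℝ (Fin 2)

/-! ### The classes of potentials -/

/-- The open interval `(0, S)`, where `S` may be `+∞`. -/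
def openInterval (S : EReal) : Set ℝ := {x : ℝ | 0 < x ∧ (x : EReal) < S}

/-- The quotient `V' / V''`. -/
noncomputable def derivRatio (V : ℝ → ℝ) (x : ℝ) : ℝ := deriv V x / deriv (deriv V) x

/-- On `(0, S)` the potential is decreasing and convex, with `V' < 0 < V''`, and `V' / V''` is
decreasing. -/
structure ConvexNearZero (V : ℝ → ℝ) (S : EReal) : Prop where
  deriv_neg : ∀ x ∈ openInterval S, deriv V x < 0
  deriv2_pos : ∀ x ∈ openInterval S, 0 < deriv (deriv V) x
  ratio_antitone : AntitoneOn (derivRatio V) (openInterval S)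

/-- The class `𝒱`. Only the values of `V` on `(0, ∞)` matter. The value at `0` of the derivative
of `V' / V''` is the one-sided derivative of its continuous extension to `0`. -/
structure ClassV (V : ℝ → ℝ) : Prop where
  smooth : ContDiffOn ℝ ∞ V (Ioi 0)
  singular : Tendsto V (𝓝[>] 0) atTop
  convex_near_zero : ∃ S : EReal, 0 < S ∧ ConvexNearZero V S
  slope_at_zero : ∃ g₀ d : ℝ, Tendsto (derivRatio V) (𝓝[>] 0) (𝓝 g₀) ∧
    HasDerivWithinAt (Function.update (derivRatio V) 0 g₀) d (Ioi 0) 0 ∧ d < -(1 / 2)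

/-- The class `𝒱*`: `V(l x) / V(l) → 1` as `l → 0⁺`, uniformly for `x` in every `[1, M]`. -/
structure ClassVStar (V : ℝ → ℝ) : Prop extends ClassV V where
  zero_homogeneous : ∀ M : ℝ, 1 ≤ M →
    TendstoUniformlyOn (fun l x : ℝ => V (l * x) / V l) (fun _ => 1) (𝓝[>] 0) (Icc 1 M)

/-- `R = min {T, S}`, where `(0, S)` is an interval of convexity and monotonicity and where
`V' / V'' ≤ - x / 2` on `(0, T)`; the values `+∞` are allowed. -/
def IsAdmissibleRadius (V : ℝ → ℝ) (R : EReal) : Prop :=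
  ∃ S T : EReal, 0 < S ∧ 0 < T ∧ ConvexNearZero V S ∧
    (∀ x ∈ openInterval T, derivRatio V x ≤ -x / 2) ∧ R = min T S

/-! ### The initial value problems -/

/-- `u` solves `u'' = F(u)`, `(u(0), u'(0)) = ν` on the interval `I` (which contains `0`). -/
def SolvesIVP (F : Plane → Plane) (ν : Plane × Plane) (I : Set ℝ) (u : ℝ → Plane) : Prop :=
  ∃ v : ℝ → Plane, u 0 = ν.1 ∧ v 0 = ν.2 ∧
    ∀ t ∈ I, HasDerivWithinAt u (v t) I t ∧ HasDerivWithinAt v (F (u t)) I t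

/-- Classical (collision-free) solution of the singular problem `u'' = ∇ V(|u|)` on `I`. -/
def IsClassicalSolution (V : ℝ → ℝ) (ν : Plane × Plane) (I : Set ℝ) (u : ℝ → Plane) : Prop :=
  SolvesIVP (gradient fun y : Plane => V ‖y‖) ν I u ∧ ∀ t ∈ I, u t ≠ 0

/-- The smoothed potential `V_ε(x) = V(√(x² + ε²))`. -/
noncomputable def smoothed (V : ℝ → ℝ) (ε : ℝ) (x : ℝ) : ℝ := V (Real.sqrt (x ^ 2 + ε ^ 2))

/-- Solution of the regularized problem `u'' = ∇ V_ε(|u|)` on `I`. -/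
def IsRegularizedSolution (V : ℝ → ℝ) (ε : ℝ) (ν : Plane × Plane) (I : Set ℝ)
    (u : ℝ → Plane) : Prop :=
  SolvesIVP (gradient fun y : Plane => smoothed V ε ‖y‖) ν I u

/-- `u` is the collision solution with initial data `ν`, and `T₀` is its collision time. -/
def CollidesAt (V : ℝ → ℝ) (ν : Plane × Plane) (T₀ : ℝ) (u : ℝ → Plane) : Prop :=
  0 < T₀ ∧ IsClassicalSolution V ν (Ico 0 T₀) u ∧ Tendsto u (𝓝[<] T₀) (𝓝 0)

/-- Initial data with position in the closed ball of radius `R`, the centre being excluded. -/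
def ballData (R : EReal) : Set (Plane × Plane) := {ν | ν.1 ≠ 0 ∧ ((‖ν.1‖ : ℝ) : EReal) ≤ R}

/-- The set `S(V)` of initial data in the ball that lead to a collision. -/
def collisionData (V : ℝ → ℝ) (R : EReal) : Set (Plane × Plane) :=
  {ν | ν ∈ ballData R ∧ ∃ (T₀ : ℝ) (u : ℝ → Plane), CollidesAt V ν T₀ u}

/-- The transmission solution on `[0, 2 T₀]`: the collision solution up to the collision at time
`T₀`, followed by its reflection through the origin. -/
noncomputable def transmission (T₀ : ℝ) (u : ℝ → Plane) (t : ℝ) : Plane :=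
  if t < T₀ then u t else if t = T₀ then 0 else -u (2 * T₀ - t)

/-! ### Strong regularizability -/

/-- The regularized solutions `u_{ε,ν}` exist on `[0, τ]` for `(ε, ν)` close to `(0⁺, ν₀)` and
converge to `w`, uniformly on `[0, τ]`, as `(ε, ν) → (0⁺, ν₀)`. -/
def IsRegularizedLimit (V : ℝ → ℝ) (ν₀ : Plane × Plane) (τ : ℝ) (w : ℝ → Plane) : Prop :=
  ∀ δ > 0, ∀ᶠ p : ℝ × (Plane × Plane) in 𝓝[>] 0 ×ˢ 𝓝 ν₀,
    (∃ u, IsRegularizedSolution V p.1 p.2 (Icc 0 τ) u) ∧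
    ∀ u, IsRegularizedSolution V p.1 p.2 (Icc 0 τ) u → ∀ t ∈ Icc 0 τ, dist (u t) (w t) < δ

/-- The pairs (initial data, time) at which the extended flow is defined: times up to `2 T₀` for
data leading to a collision at time `T₀`, times of existence of the solution for the other data. -/
def flowDomain (V : ℝ → ℝ) (R : EReal) : Set ((Plane × Plane) × ℝ) :=
  {z | z.1 ∈ ballData R ∧ 0 ≤ z.2 ∧
    ((∃ (T₀ : ℝ) (u : ℝ → Plane), CollidesAt V z.1 T₀ u ∧ z.2 ≤ 2 * T₀) ∨
      (z.1 ∉ collisionData V R ∧ ∃ u, IsClassicalSolution V z.1 (Icc 0 z.2) u))}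

/-- `Φ ν t` is the extended flow: the transmission solution for data in `S(V)`, the classical
solution for the other data. This determines `Φ` on its domain. -/
structure IsExtendedFlow (V : ℝ → ℝ) (R : EReal) (Φ : Plane × Plane → ℝ → Plane) : Prop where
  eq_transmission : ∀ ν ∈ collisionData V R, ∀ (T₀ : ℝ) (u : ℝ → Plane), CollidesAt V ν T₀ u →
    ∀ t ∈ Icc 0 (2 * T₀), Φ ν t = transmission T₀ u t
  eq_classical : ∀ ν ∈ ballData R, ν ∉ collisionData V R → ∀ (τ : ℝ) (u : ℝ → Plane),
    IsClassicalSolution V ν (Icc 0 τ) u → ∀ t ∈ Icc 0 τ, Φ ν t = u t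

/-- Strong regularizability via smoothing of the potential for initial positions in the ball of
radius `R`, with the transmission solution as the limit. The extended flow is continuous: before
the end of the lifetime its domain is a neighbourhood, among the data in the ball and the
nonnegative times, and on its domain the flow is continuous. -/
structure StronglyRegularizable (V : ℝ → ℝ) (R : EReal) : Prop where
  limit : ∀ ν ∈ collisionData V R, ∀ (T₀ : ℝ) (u : ℝ → Plane), CollidesAt V ν T₀ u →
    IsRegularizedLimit V ν (2 * T₀) (transmission T₀ u)
  continuous_flow : ∃ Φ : Plane × Plane → ℝ → Plane, IsExtendedFlow V R Φ ∧
    (∀ (ν : Plane × Plane) (t s : ℝ), 0 ≤ t → t < s → (ν, s) ∈ flowDomain V R →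
      flowDomain V R ∈ 𝓝[ballData R ×ˢ Ici 0] (ν, t)) ∧
    ContinuousOn (fun z : (Plane × Plane) × ℝ => Φ z.1 z.2) (flowDomain V R)

/-! Near the centre the force is negligible compared with the speed. Homogeneity of degree zero
together with convexity gives `-x V'(x) ≤ κ V(x)` near `0` for every `κ > 0`
(`ClassVStar.exists_slowNearZero`), while conservation of energy makes `‖v‖²` at least `V`. Hence
`⟨u, v⟩` grows at a rate of at least `‖v‖² / 2`: an inward trajectory spends little time near the
centre (`Orbit.length_le_of_inner_neg`). The direction of its velocity turns by at most `8 κ` on the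
way (`Orbit.dist_normalize_le`).

If `ε ≠ 0` or the angular momentum is nonzero, such a trajectory reaches a point where `⟨u, v⟩ = 0`
with `v ≠ 0` (`exists_pericentre`). From there it is continued by its own time reversal composed
with the reflection along the velocity at that point (`Orbit.reflect_at_pericentre`). As the data
approach those of a collision, which is radial, this velocity becomes parallel to the collision
line, on which the reflection acts as `-1`. That is why the limit is the transmission solution. If
`ε = 0` and the angular momentum vanishes, the trajectory collides at a nearby time
(`exists_collision`), and its transmission is close to the given one.

`ClassVStar.eventually_near_transmission` combines both cases, uniformly in `(ε, ν)` near `(0, ν̄)`.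
With `ε > 0` it yields the limit of the smoothed problems; with `ε = 0` it yields continuity of the
extended flow at colliding data. Elsewhere continuity is the usual continuous dependence. -/

/-! ### Autonomous differential equations: existence, continuous dependence, gluing. -/

section AutonomousODE

variable {E : Type*} [NormedAddCommGroup E] [NormedSpace ℝ E]

theorem hasDerivWithinAt_Ici_of_Icc {x : ℝ → E} {x' : E} {a b t : ℝ}
    (h : HasDerivWithinAt x x' (Icc a b) t) (ht : t ∈ Ico a b) :
    HasDerivWithinAt x x' (Ici t) t :=
  h.mono_of_mem_nhdsWithin (mem_of_superset (Icc_mem_nhdsGE ht.2)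
    (Icc_subset_Icc_left ht.1))

/-- A `C¹` vector field on an open set agrees, near a given compact subset, with a globally
Lipschitz and bounded vector field. -/
theorem exists_lipschitz_cutoff [FiniteDimensional ℝ E] {f : E → E} {Ω C : Set E}
    (hΩ : IsOpen Ω) (hf : ContDiffOn ℝ 1 f Ω) (hC : IsCompact C) (hCΩ : C ⊆ Ω) :
    ∃ (g : E → E) (K M : NNReal) (N : Set E), LipschitzWith K g ∧ (∀ x, ‖g x‖ ≤ M) ∧
      IsOpen N ∧ C ⊆ N ∧ N ⊆ Ω ∧ EqOn g f N := by
  obtain ⟨U, hU, hCU, hUΩ, hUc⟩ := exists_open_between_and_isCompact_closure hC hΩ hCΩ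
  obtain ⟨χ, h0, h1, -⟩ := exists_contMDiffMap_zero_one_nhds_of_isClosed (n := 1)
    (modelWithCornersSelf ℝ E) hU.isClosed_compl hC.isClosed
    (disjoint_compl_left_iff_subset.2 hCU)
  have hχ : ContDiff ℝ 1 χ := χ.contMDiff.contDiff
  set g : E → E := fun x => χ x • f x with hg
  have hgs : HasCompactSupport g := by
    refine HasCompactSupport.of_support_subset_isCompact hUc fun x hx => ?_
    by_contra hxU
    apply hx
    have : χ x = 0 := h0.self_of_nhdsSet x fun h => hxU (subset_closure h)
    simp [hg, this]
  have hgd : ContDiff ℝ 1 g := by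
    rw [contDiff_iff_contDiffAt]
    intro x
    by_cases hx : x ∈ Ω
    · exact hχ.contDiffAt.smul (hf.contDiffAt (hΩ.mem_nhds hx))
    · have hxU : x ∈ Uᶜ := fun h => hx (hUΩ (subset_closure h))
      have : g =ᶠ[𝓝 x] fun _ => 0 := by
        filter_upwards [h0.filter_mono (nhds_le_nhdsSet hxU)] with y hy
        simp [hg, hy]
      exact contDiffAt_const.congr_of_eventuallyEq this
  obtain ⟨K, hK⟩ := ContDiff.lipschitzWith_of_hasCompactSupport hgs hgd one_ne_zero
  obtain ⟨M, hM⟩ := hgs.exists_bound_of_continuous hgd.continuous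
  obtain ⟨N, hN, hCN, hN1⟩ := eventually_nhdsSet_iff_exists.1 h1
  refine ⟨g, K, M.toNNReal, N ∩ U, hK, fun x => (hM x).trans (Real.le_coe_toNNReal M),
    hN.inter hU, subset_inter hCN hCU, fun x hx => hUΩ (subset_closure hx.2), fun x hx => ?_⟩
  simp [hg, hN1 x hx.1]

theorem exists_isIntegralCurveOn_of_lipschitz [CompleteSpace E] {g : E → E} {K M : NNReal}
    (hK : LipschitzWith K g) (hM : ∀ x, ‖g x‖ ≤ M) (x₀ : E) {τ : ℝ} (hτ : 0 ≤ τ) :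
    ∃ x : ℝ → E, x 0 = x₀ ∧ IsIntegralCurveOn x (fun _ => g) (Icc 0 τ) := by
  -- A field bounded by `M` cannot leave the ball of radius `M τ` within time `τ`, so one
  -- application covers the whole interval.
  have h := IsPicardLindelof.of_time_independent (f := g) (tmin := 0) (tmax := τ)
    (t₀ := ⟨0, le_rfl, hτ⟩) (x₀ := x₀) (a := M * τ.toNNReal) (r := 0) (L := M) (K := K)
    (fun x _ => hM x) hK.lipschitzOnWith (by simp [hτ])
  obtain ⟨x, hx, h⟩ := h.exists_eq_forall_mem_Icc_hasDerivWithinAt₀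
  exact ⟨x, hx, h⟩

theorem IsIntegralCurveOn.congr_field {f g : E → E} {x : ℝ → E} {I : Set ℝ}
    (hx : IsIntegralCurveOn x (fun _ => f) I) (h : ∀ t ∈ I, g (x t) = f (x t)) :
    IsIntegralCurveOn x (fun _ => g) I := fun t ht => by
  simpa only [h t ht] using hx t ht

theorem IsIntegralCurveOn.dist_le_of_lipschitz {g : E → E} {K : NNReal}
    (hK : LipschitzWith K g) {x y : ℝ → E} {τ : ℝ}
    (hx : IsIntegralCurveOn x (fun _ => g) (Icc 0 τ))
    (hy : IsIntegralCurveOn y (fun _ => g) (Icc 0 τ)) :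
    ∀ t ∈ Icc 0 τ, dist (x t) (y t) ≤ dist (x 0) (y 0) * Real.exp (K * t) := by
  intro t ht
  simpa using dist_le_of_trajectories_ODE (v := fun _ => g) (fun _ => hK) hx.continuousOn
    (fun s hs => hasDerivWithinAt_Ici_of_Icc (hx s (Ico_subset_Icc_self hs)) hs)
    hy.continuousOn
    (fun s hs => hasDerivWithinAt_Ici_of_Icc (hy s (Ico_subset_Icc_self hs)) hs) le_rfl t ht

theorem IsIntegralCurveOn.eqOn_of_contDiffOn [FiniteDimensional ℝ E] {f : E → E} {Ω : Set E}
    (hΩ : IsOpen Ω) (hf : ContDiffOn ℝ 1 f Ω) {x y : ℝ → E} {τ : ℝ}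
    (hx : IsIntegralCurveOn x (fun _ => f) (Icc 0 τ))
    (hy : IsIntegralCurveOn y (fun _ => f) (Icc 0 τ))
    (hxΩ : ∀ t ∈ Icc 0 τ, x t ∈ Ω) (hyΩ : ∀ t ∈ Icc 0 τ, y t ∈ Ω) (h0 : x 0 = y 0) :
    EqOn x y (Icc 0 τ) := by
  obtain ⟨g, K, M, N, hK, -, -, hCN, -, hgf⟩ := exists_lipschitz_cutoff hΩ hf
    ((isCompact_Icc.image_of_continuousOn hx.continuousOn).union
      (isCompact_Icc.image_of_continuousOn hy.continuousOn))
    (union_subset (image_subset_iff.2 hxΩ) (image_subset_iff.2 hyΩ))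
  intro t ht
  have := IsIntegralCurveOn.dist_le_of_lipschitz hK
    (hx.congr_field fun t ht => hgf (hCN (Or.inl (mem_image_of_mem _ ht))))
    (hy.congr_field fun t ht => hgf (hCN (Or.inr (mem_image_of_mem _ ht)))) t ht
  rw [h0, dist_self, zero_mul] at this
  exact dist_le_zero.1 this

/-- Continuous dependence on the initial point, including existence slightly beyond the time
interval of the reference solution. -/
theorem IsIntegralCurveOn.exists_nearby [FiniteDimensional ℝ E] {f : E → E} {Ω : Set E}
    (hΩ : IsOpen Ω) (hf : ContDiffOn ℝ 1 f Ω) {y : ℝ → E} {τ : ℝ} (hτ : 0 ≤ τ)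
    (hy : IsIntegralCurveOn y (fun _ => f) (Icc 0 τ)) (hyΩ : ∀ t ∈ Icc 0 τ, y t ∈ Ω)
    {δ : ℝ} (hδ : 0 < δ) :
    ∃ η > 0, ∀ᶠ x₀ in 𝓝 (y 0), ∃ x : ℝ → E, x 0 = x₀ ∧
      IsIntegralCurveOn x (fun _ => f) (Icc 0 (τ + η)) ∧
      ∀ t ∈ Icc 0 (τ + η), x t ∈ Ω ∧ dist (x t) (y (min t τ)) < δ := by
  have hC := isCompact_Icc.image_of_continuousOn hy.continuousOn
  have hCΩ : y '' Icc 0 τ ⊆ Ω := image_subset_iff.2 hyΩ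
  obtain ⟨g, K, M, N, hK, hM, hN, hCN, hNΩ, hgf⟩ := exists_lipschitz_cutoff hΩ hf hC hCΩ
  obtain ⟨ρ, hρ, hρN⟩ := hC.exists_thickening_subset_open hN hCN
  have := FiniteDimensional.complete ℝ E
  obtain ⟨z, hz0, hz⟩ := exists_isIntegralCurveOn_of_lipschitz hK hM (y 0)
    (add_nonneg hτ zero_le_one)
  have hzy : ∀ t ∈ Icc 0 τ, z t = y t := fun t ht => by
    have := IsIntegralCurveOn.dist_le_of_lipschitz hK
      (hz.mono (Icc_subset_Icc_right (by linarith : τ ≤ τ + 1)))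
      (hy.congr_field fun t ht => hgf (hCN (mem_image_of_mem _ ht))) t ht
    rw [hz0, dist_self, zero_mul] at this
    exact dist_le_zero.1 this
  -- Closeness `ρ` keeps trajectories in `N`, where `g = f`. One half of `r` is for the motion of
  -- `z` after time `τ`, the other for the exponential bound on `dist (x t) (z t)`.
  set r := min ρ δ with hr
  have hr0 : 0 < r := lt_min hρ hδ
  obtain ⟨η, hη0, hη1, hη⟩ : ∃ η > 0, η ≤ 1 ∧ ∀ t ∈ Icc τ (τ + η), dist (z t) (z τ) < r / 2 := by
    have hcont := hz.continuousOn τ ⟨hτ, by linarith⟩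
    obtain ⟨η, hη, h⟩ := Metric.continuousWithinAt_iff.1 hcont (r / 2) (half_pos hr0)
    refine ⟨min (η / 2) 1, by positivity, min_le_right _ _, fun t ht => h ⟨?_, ?_⟩ ?_⟩
    · exact hτ.trans ht.1
    · have := min_le_right (η / 2) 1
      linarith [ht.2]
    · rw [Real.dist_eq, abs_of_nonneg (by linarith [ht.1])]
      have := min_le_left (η / 2) 1
      linarith [ht.2]
  refine ⟨η, hη0, ?_⟩
  have hexp := Real.exp_pos (K * (τ + 1))
  filter_upwards [Metric.ball_mem_nhds (y 0) (div_pos (half_pos hr0) hexp)] with x₀ hx₀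
  obtain ⟨x, hx0, hx⟩ := exists_isIntegralCurveOn_of_lipschitz hK hM x₀
    (add_nonneg hτ zero_le_one)
  have hclose : ∀ t ∈ Icc 0 (τ + η), dist (x t) (y (min t τ)) < r := by
    intro t ht
    have ht' : t ∈ Icc 0 (τ + 1) := ⟨ht.1, by linarith [ht.2]⟩
    have h1 := IsIntegralCurveOn.dist_le_of_lipschitz hK hx hz t ht'
    have h2 : dist (x t) (z t) < r / 2 := by
      refine h1.trans_lt ?_
      rw [hx0, hz0]
      calc _ ≤ dist x₀ (y 0) * Real.exp (K * (τ + 1)) := by gcongr; exact ht'.2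
        _ < r / 2 / Real.exp (K * (τ + 1)) * Real.exp (K * (τ + 1)) := by
          gcongr; exact hx₀
        _ = r / 2 := by field_simp
    have h3 : dist (z t) (y (min t τ)) < r / 2 := by
      rcases le_total t τ with h | h
      · rw [min_eq_left h, hzy t ⟨ht.1, h⟩, dist_self]; exact half_pos hr0
      · rw [min_eq_right h, ← hzy τ ⟨hτ, le_rfl⟩]; exact hη t ⟨h, ht.2⟩
    linarith [dist_triangle (x t) (z t) (y (min t τ))]
  have hxN : ∀ t ∈ Icc 0 (τ + η), x t ∈ N := fun t ht => hρN (Metric.mem_thickening_iff.2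
    ⟨y (min t τ), mem_image_of_mem _ ⟨le_min ht.1 hτ, min_le_right _ _⟩,
      (hclose t ht).trans_le (min_le_left _ _)⟩)
  exact ⟨x, hx0, (hx.mono (Icc_subset_Icc_right (by linarith))).congr_field
    fun t ht => (hgf (hxN t ht)).symm, fun t ht =>
    ⟨hNΩ (hxN t ht), (hclose t ht).trans_le (min_le_right _ _)⟩⟩

/-- A solution which cannot leave a compact set, nor live longer than `τ`, as long as `φ < 0`
along it, reaches the zero set of `φ`. -/
theorem exists_isIntegralCurveOn_until_zero [FiniteDimensional ℝ E] {f : E → E} {Ω C : Set E}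
    (hΩ : IsOpen Ω) (hf : ContDiffOn ℝ 1 f Ω) (hC : IsCompact C) (hCΩ : C ⊆ Ω) {φ : E → ℝ}
    (hφ : Continuous φ) {x₀ : E} (hx₀ : x₀ ∈ C) (hφ₀ : φ x₀ < 0) {τ : ℝ} (hτ : 0 ≤ τ)
    (H : ∀ (x : ℝ → E) (s : ℝ), 0 ≤ s → x 0 = x₀ → IsIntegralCurveOn x (fun _ => f) (Icc 0 s) →
      (∀ t ∈ Icc 0 s, x t ∈ Ω) → (∀ t ∈ Ico 0 s, φ (x t) < 0) → x s ∈ C ∧ s ≤ τ) :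
    ∃ (s : ℝ) (x : ℝ → E), 0 < s ∧ x 0 = x₀ ∧ IsIntegralCurveOn x (fun _ => f) (Icc 0 s) ∧
      (∀ t ∈ Icc 0 s, x t ∈ C) ∧ (∀ t ∈ Ico 0 s, φ (x t) < 0) ∧ φ (x s) = 0 := by
  obtain ⟨g, K, M, N, hK, hM, hN, hCN, hNΩ, hgf⟩ := exists_lipschitz_cutoff hΩ hf hC hCΩ
  have := FiniteDimensional.complete ℝ E
  obtain ⟨x, hx0, hx⟩ := exists_isIntegralCurveOn_of_lipschitz hK hM x₀
    (add_nonneg hτ zero_le_one)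
  have key : ∀ s ∈ Icc 0 (τ + 1), (∀ t ∈ Ico 0 s, φ (x t) < 0) →
      IsIntegralCurveOn x (fun _ => f) (Icc 0 s) ∧ ∀ t ∈ Icc 0 s, x t ∈ C := by
    intro s hs hneg
    have hxs := hx.mono (Icc_subset_Icc_right hs.2)
    have hcurve : ∀ r ∈ Icc 0 s, (∀ t ∈ Icc 0 r, x t ∈ N) →
        IsIntegralCurveOn x (fun _ => f) (Icc 0 r) ∧ x r ∈ C := by
      intro r hr hrN
      have h1 := (hxs.mono (Icc_subset_Icc_right hr.2)).congr_field
        fun t ht => (hgf (hrN t ht)).symm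
      exact ⟨h1, (H x r hr.1 hx0 h1 (fun t ht => hNΩ (hrN t ht))
        fun t ht => hneg t ⟨ht.1, ht.2.trans_le hr.2⟩).1⟩
    -- The assumption `H` speaks of `f`, so it applies only while `x` is in `N`, and then it puts
    -- `x` in `C`. At a first exit time from `N` the point would lie in `closure C = C ⊆ N`.
    have hN' : ∀ t ∈ Icc 0 s, x t ∈ N := by
      by_contra! hne
      have hcl : IsCompact (Icc 0 s ∩ x ⁻¹' Nᶜ) :=
        isCompact_Icc.of_isClosed_subset
          (hxs.continuousOn.preimage_isClosed_of_isClosed isClosed_Icc hN.isClosed_compl)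
          inter_subset_left
      obtain ⟨t₀, ⟨ht₀, ht₀N⟩, hmin⟩ := hcl.exists_isLeast
        (let ⟨t, ht, htN⟩ := hne; ⟨t, ht, htN⟩)
      have hbefore : ∀ t ∈ Ico 0 t₀, x t ∈ N := fun t ht => by
        by_contra htN
        exact absurd (hmin ⟨⟨ht.1, ht.2.le.trans ht₀.2⟩, htN⟩) (not_le.2 ht.2)
      have hpos : 0 < t₀ := by
        refine lt_of_le_of_ne ht₀.1 fun h => ht₀N ?_
        rw [← h, hx0]
        exact hCN hx₀
      have hmem : ∀ t ∈ Ico 0 t₀, x t ∈ C := fun t ht =>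
        (hcurve t ⟨ht.1, ht.2.le.trans ht₀.2⟩
          fun r hr => hbefore r ⟨hr.1, hr.2.trans_lt ht.2⟩).2
      have hcont : ContinuousWithinAt x (Ico 0 t₀) t₀ :=
        (hxs.continuousOn t₀ ht₀).mono fun t ht => ⟨ht.1, ht.2.le.trans ht₀.2⟩
      have hcl₀ : t₀ ∈ closure (Ico 0 t₀) := by
        rw [closure_Ico hpos.ne]
        exact right_mem_Icc.2 hpos.le
      have hx₀C : x t₀ ∈ closure C := hcont.mem_closure hcl₀ hmem
      rw [hC.isClosed.closure_eq] at hx₀C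
      exact ht₀N (hCN hx₀C)
    exact ⟨(hcurve s ⟨hs.1, le_rfl⟩ hN').1, fun t ht =>
      (hcurve t ht fun r hr => hN' r ⟨hr.1, hr.2.trans ht.2⟩).2⟩
  have hcontφ : ContinuousOn (fun t => φ (x t)) (Icc 0 (τ + 1)) :=
    hφ.comp_continuousOn hx.continuousOn
  -- If `φ` stayed negative on `[0, τ + 1]`, then `H` would give `τ + 1 ≤ τ`.
  have hne : (Icc 0 (τ + 1) ∩ (fun t => φ (x t)) ⁻¹' Ici 0).Nonempty := by
    by_contra hemp
    have hneg : ∀ t ∈ Icc 0 (τ + 1), φ (x t) < 0 := fun t ht => by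
      by_contra h
      exact hemp ⟨t, ht, not_lt.1 h⟩
    have h1 := key (τ + 1) ⟨by linarith, le_rfl⟩ fun t ht => hneg t (Ico_subset_Icc_self ht)
    have h2 := (H x (τ + 1) (by linarith) hx0 h1.1 (fun t ht => hCΩ (h1.2 t ht))
      fun t ht => hneg t (Ico_subset_Icc_self ht)).2
    linarith
  have hcl : IsCompact (Icc 0 (τ + 1) ∩ (fun t => φ (x t)) ⁻¹' Ici 0) :=
    isCompact_Icc.of_isClosed_subset
      (hcontφ.preimage_isClosed_of_isClosed isClosed_Icc isClosed_Ici) inter_subset_left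
  obtain ⟨s, ⟨hs, hs0⟩, hmin⟩ := hcl.exists_isLeast hne
  have hneg : ∀ t ∈ Ico 0 s, φ (x t) < 0 := fun t ht => by
    by_contra h
    exact absurd (hmin ⟨⟨ht.1, ht.2.le.trans hs.2⟩, not_lt.1 h⟩) (not_le.2 ht.2)
  obtain ⟨c, hc, hc0⟩ := intermediate_value_Icc hs.1
    (hcontφ.mono (Icc_subset_Icc_right hs.2)) ⟨by simpa [hx0] using hφ₀.le, hs0⟩
  have hcs : c = s := le_antisymm hc.2
    (hmin ⟨⟨hc.1, hc.2.trans hs.2⟩, (show (0 : ℝ) ≤ φ (x c) from hc0.ge)⟩)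
  subst hcs
  have hpos : 0 < c := by
    refine lt_of_le_of_ne hs.1 fun h => ?_
    have h0 : φ (x c) = 0 := hc0
    rw [← h, hx0] at h0
    exact hφ₀.ne h0
  exact ⟨c, x, hpos, hx0, (key c hs hneg).1, (key c hs hneg).2, hneg, hc0⟩

theorem IsIntegralCurveOn.glue {f : ℝ → E → E} {x y : ℝ → E} {I J : Set ℝ} {a : ℝ}
    (hx : IsIntegralCurveOn x f I) (hy : IsIntegralCurveOn y f J)
    (hI : I ⊆ Iic a) (hJ : J ⊆ Ici a) (haI : a ∈ I) (haJ : a ∈ J) (hxy : x a = y a) :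
    IsIntegralCurveOn (fun t => if t < a then x t else y t) f (I ∪ J) := by
  set z : ℝ → E := fun t => if t < a then x t else y t with hz
  have hzx : EqOn z x I := fun t ht => by
    rcases lt_or_eq_of_le (show t ≤ a from hI ht) with h | h
    · simp [hz, h]
    · simp [hz, h, hxy]
  have hzy : EqOn z y J := fun t ht => by simp [hz, not_lt.2 (show a ≤ t from hJ ht)]
  intro t ht
  have h1 : HasDerivWithinAt z (f t (z t)) I t := by
    by_cases htI : t ∈ I
    · have := hx t htI
      rw [hzx htI]
      exact this.congr hzx (hzx htI)
    -- A point of `J` in the closure of `I` must be `a`, which belongs to `I`. So outside `I`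
    -- differentiability within `I` is an empty condition.
    · refine hasDerivWithinAt_iff_hasFDerivWithinAt.2 <| .of_notMem_closure fun hcl => htI ?_
      have h3 : a ≤ t := hJ (ht.resolve_left htI)
      have h4 : t ≤ a := closure_minimal hI isClosed_Iic hcl
      rwa [le_antisymm h4 h3]
  have h2 : HasDerivWithinAt z (f t (z t)) J t := by
    by_cases htJ : t ∈ J
    · have := hy t htJ
      rw [hzy htJ]
      exact this.congr hzy (hzy htJ)
    · refine hasDerivWithinAt_iff_hasFDerivWithinAt.2 <| .of_notMem_closure fun hcl => htJ ?_
      have h3 : t ≤ a := hI (ht.resolve_right htJ)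
      have h4 : a ≤ t := closure_minimal hJ isClosed_Ici hcl
      rwa [le_antisymm h3 h4]
  exact h1.union h2

/-- Solutions on `[0, sₙ]` with the same initial point have a common extension to the union of the
intervals `[0, sₙ)`. -/
theorem exists_isIntegralCurveOn_iUnion_Ico [FiniteDimensional ℝ E] {f : E → E} {Ω : Set E}
    (hΩ : IsOpen Ω) (hf : ContDiffOn ℝ 1 f Ω) {y : ℕ → ℝ → E} {s : ℕ → ℝ} {x₀ : E}
    (h0 : ∀ n, y n 0 = x₀) (hy : ∀ n, IsIntegralCurveOn (y n) (fun _ => f) (Icc 0 (s n)))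
    (hyΩ : ∀ n, ∀ t ∈ Icc 0 (s n), y n t ∈ Ω) :
    ∃ x : ℝ → E, IsIntegralCurveOn x (fun _ => f) (⋃ n, Ico 0 (s n)) ∧
      ∀ n, EqOn x (y n) (Ico 0 (s n)) := by
  classical
  have hagree : ∀ m n, ∀ t ∈ Icc 0 (min (s m) (s n)), y m t = y n t := fun m n =>
    IsIntegralCurveOn.eqOn_of_contDiffOn hΩ hf
      ((hy m).mono (Icc_subset_Icc_right (min_le_left _ _)))
      ((hy n).mono (Icc_subset_Icc_right (min_le_right _ _)))
      (fun t ht => hyΩ m t ⟨ht.1, ht.2.trans (min_le_left _ _)⟩)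
      (fun t ht => hyΩ n t ⟨ht.1, ht.2.trans (min_le_right _ _)⟩) ((h0 m).trans (h0 n).symm)
  let x : ℝ → E := fun t => if h : ∃ n, t < s n then y (Nat.find h) t else x₀
  have hx : ∀ n, EqOn x (y n) (Ico 0 (s n)) := fun n t ht => by
    have h : ∃ n, t < s n := ⟨n, ht.2⟩
    simp only [x, dif_pos h]
    exact hagree _ _ t ⟨ht.1, le_min (Nat.find_spec h).le ht.2.le⟩
  refine ⟨x, fun t ht => ?_, hx⟩
  obtain ⟨n, hn⟩ := mem_iUnion.1 ht
  have h1 : HasDerivWithinAt x (f (x t)) (Ico 0 (s n)) t := by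
    rw [hx n hn]
    exact ((hy n t (Ico_subset_Icc_self hn)).mono Ico_subset_Icc_self).congr (hx n) (hx n hn)
  refine h1.mono_of_mem_nhdsWithin ?_
  filter_upwards [self_mem_nhdsWithin, mem_nhdsWithin_of_mem_nhds (Iio_mem_nhds hn.2)]
    with r hr hrn
  obtain ⟨m, hm⟩ := mem_iUnion.1 hr
  exact ⟨hm.1, hrn⟩

end AutonomousODE

/-! ### The central field in phase space extended by `ε`, and its symmetries. -/

/-- `(u, v)` is a trajectory on `I` of the central field `u'' = G (|u|² + ε²) u`, which avoids the
singularity `|u|² + ε² = 0`. -/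
structure Orbit (G : ℝ → ℝ) (ε : ℝ) (I : Set ℝ) (u v : ℝ → Plane) : Prop where
  pos : ∀ t ∈ I, 0 < ‖u t‖ ^ 2 + ε ^ 2
  deriv_fst : ∀ t ∈ I, HasDerivWithinAt u (v t) I t
  deriv_snd : ∀ t ∈ I, HasDerivWithinAt v (G (‖u t‖ ^ 2 + ε ^ 2) • u t) I t

/-- The vector field of the central field in the phase space extended by the parameter `ε`. -/
noncomputable def phaseField (G : ℝ → ℝ) (x : ℝ × Plane × Plane) : ℝ × Plane × Plane :=
  (0, x.2.2, G (‖x.2.1‖ ^ 2 + x.1 ^ 2) • x.2.1)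

/-- The complement of the singularity in the extended phase space. -/
def phaseDomain : Set (ℝ × Plane × Plane) := {x | 0 < ‖x.2.1‖ ^ 2 + x.1 ^ 2}

theorem isOpen_phaseDomain : IsOpen phaseDomain :=
  isOpen_lt continuous_const (by fun_prop)

theorem contDiffOn_phaseField {G : ℝ → ℝ} (hG : ContDiffOn ℝ 1 G (Ioi 0)) :
    ContDiffOn ℝ 1 (phaseField G) phaseDomain := by
  have h1 : ContDiff ℝ 1 fun x : ℝ × Plane × Plane => ‖x.2.1‖ ^ 2 + x.1 ^ 2 :=
    (contDiff_snd.fst.norm_sq ℝ).add (contDiff_fst.pow 2)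
  exact contDiffOn_const.prodMk (contDiff_snd.snd.contDiffOn.prodMk
    ((hG.comp h1.contDiffOn fun x hx => hx).smul contDiff_snd.fst.contDiffOn))

namespace Orbit

variable {G : ℝ → ℝ} {ε : ℝ} {I : Set ℝ} {u v : ℝ → Plane}

theorem mono (h : Orbit G ε I u v) {J : Set ℝ} (hJ : J ⊆ I) : Orbit G ε J u v :=
  ⟨fun t ht => h.pos t (hJ ht), fun t ht => (h.deriv_fst t (hJ ht)).mono hJ,
    fun t ht => (h.deriv_snd t (hJ ht)).mono hJ⟩

/-- With `ε` as a constant component of the state, joint dependence on `(ε, ν)` becomes dependence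
on the initial point of one autonomous equation. -/
theorem isIntegralCurveOn (h : Orbit G ε I u v) :
    IsIntegralCurveOn (fun t => (ε, u t, v t)) (fun _ => phaseField G) I := fun t ht =>
  (hasDerivWithinAt_const t I ε).prodMk ((h.deriv_fst t ht).prodMk (h.deriv_snd t ht))

theorem continuousOn_fst (h : Orbit G ε I u v) : ContinuousOn u I :=
  fun t ht => (h.deriv_fst t ht).continuousWithinAt

theorem continuousOn_snd (h : Orbit G ε I u v) : ContinuousOn v I :=
  fun t ht => (h.deriv_snd t ht).continuousWithinAt

theorem of_curve {x : ℝ → ℝ × Plane × Plane} (hx : IsIntegralCurveOn x (fun _ => phaseField G) I)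
    (hε : ∀ t ∈ I, (x t).1 = ε) (hΩ : ∀ t ∈ I, x t ∈ phaseDomain) :
    Orbit G ε I (fun t => (x t).2.1) (fun t => (x t).2.2) where
  pos t ht := by
    rw [← hε t ht]
    exact hΩ t ht
  deriv_fst t ht := (hx t ht).snd.fst
  deriv_snd t ht := by
    rw [← hε t ht]
    exact (hx t ht).snd.snd

theorem fst_eq_of_curve {x : ℝ → ℝ × Plane × Plane} {τ : ℝ}
    (hx : IsIntegralCurveOn x (fun _ => phaseField G) (Icc 0 τ)) :
    ∀ t ∈ Icc 0 τ, (x t).1 = (x 0).1 :=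
  constant_of_has_deriv_right_zero hx.continuousOn.fst
    fun t ht => hasDerivWithinAt_Ici_of_Icc (hx t (Ico_subset_Icc_self ht)).fst ht

theorem unique (hG : ContDiffOn ℝ 1 G (Ioi 0)) {u' v' : ℝ → Plane} {τ : ℝ}
    (h : Orbit G ε (Icc 0 τ) u v) (h' : Orbit G ε (Icc 0 τ) u' v') (hu : u 0 = u' 0)
    (hv : v 0 = v' 0) : ∀ t ∈ Icc 0 τ, u t = u' t ∧ v t = v' t := by
  intro t ht
  have := IsIntegralCurveOn.eqOn_of_contDiffOn isOpen_phaseDomain (contDiffOn_phaseField hG)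
    h.isIntegralCurveOn h'.isIntegralCurveOn h.pos h'.pos (by simp [hu, hv]) ht
  simpa using this

theorem exists_nearby (hG : ContDiffOn ℝ 1 G (Ioi 0)) {τ : ℝ} (hτ : 0 ≤ τ)
    (h : Orbit G ε (Icc 0 τ) u v) {δ : ℝ} (hδ : 0 < δ) :
    ∃ η > 0, ∀ᶠ p : ℝ × Plane × Plane in 𝓝 (ε, u 0, v 0), ∃ u' v' : ℝ → Plane,
      u' 0 = p.2.1 ∧ v' 0 = p.2.2 ∧ Orbit G p.1 (Icc 0 (τ + η)) u' v' ∧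
      ∀ t ∈ Icc 0 (τ + η), dist (u' t) (u (min t τ)) < δ ∧ dist (v' t) (v (min t τ)) < δ := by
  obtain ⟨η, hη, hev⟩ := IsIntegralCurveOn.exists_nearby isOpen_phaseDomain
    (contDiffOn_phaseField hG) hτ h.isIntegralCurveOn h.pos hδ
  refine ⟨η, hη, hev.mono fun p hp => ?_⟩
  obtain ⟨x, hx0, hx, hxd⟩ := hp
  refine ⟨_, _, ?_, ?_, of_curve hx (fun t ht => ?_) fun t ht => (hxd t ht).1, fun t ht => ?_⟩
  · rw [hx0]
  · rw [hx0]
  · rw [fst_eq_of_curve hx t ht, hx0]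
  · have := (hxd t ht).2
    simp only [Prod.dist_eq, max_lt_iff] at this
    exact this.2

/-- Used with `φ = ⟨u, v⟩` to find a pericentre and with `φ = a - ‖u‖` to reach a small circle. The
compact set in the extended phase space is `{ε} × C`. -/
theorem exists_until_zero (hG : ContDiffOn ℝ 1 G (Ioi 0)) {C : Set (Plane × Plane)}
    (hC : IsCompact C) (hCpos : ∀ x ∈ C, 0 < ‖x.1‖ ^ 2 + ε ^ 2) {φ : Plane × Plane → ℝ}
    (hφ : Continuous φ) {ν : Plane × Plane} (hν : ν ∈ C) (hφν : φ ν < 0) {τ : ℝ} (hτ : 0 ≤ τ)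
    (H : ∀ (u v : ℝ → Plane) (s : ℝ), 0 ≤ s → u 0 = ν.1 → v 0 = ν.2 →
      Orbit G ε (Icc 0 s) u v → (∀ t ∈ Ico 0 s, φ (u t, v t) < 0) → (u s, v s) ∈ C ∧ s ≤ τ) :
    ∃ (s : ℝ) (u v : ℝ → Plane), 0 < s ∧ u 0 = ν.1 ∧ v 0 = ν.2 ∧ Orbit G ε (Icc 0 s) u v ∧
      (∀ t ∈ Ico 0 s, φ (u t, v t) < 0) ∧ φ (u s, v s) = 0 := by
  obtain ⟨s, x, hs, hx0, hx, hxC, hneg, hz⟩ := exists_isIntegralCurveOn_until_zero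
    isOpen_phaseDomain (contDiffOn_phaseField hG) (isCompact_singleton (x := ε) |>.prod hC)
    (fun x hx => by
      have := hCpos x.2 hx.2
      rw [← (show x.1 = ε from hx.1)] at this
      exact this)
    (φ := fun x => φ x.2) (hφ.comp continuous_snd) (x₀ := (ε, ν)) ⟨rfl, hν⟩ hφν hτ
    (fun x s hs hx0 hx hxΩ hneg => by
      have hε : ∀ t ∈ Icc 0 s, (x t).1 = ε := fun t ht => by rw [fst_eq_of_curve hx t ht, hx0]
      have := H _ _ s hs (by rw [hx0]) (by rw [hx0]) (of_curve hx hε hxΩ) hneg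
      exact ⟨⟨hε s (right_mem_Icc.2 hs), this.1⟩, this.2⟩)
  have hε : ∀ t ∈ Icc 0 s, (x t).1 = ε := fun t ht => (hxC t ht).1
  refine ⟨s, _, _, hs, ?_, ?_, of_curve hx hε fun t ht => ?_, hneg, hz⟩
  · rw [hx0]
  · rw [hx0]
  · have := hCpos _ (hxC t ht).2
    rw [← hε t ht] at this
    exact this

theorem exists_iUnion_Ico (hG : ContDiffOn ℝ 1 G (Ioi 0)) {U W : ℕ → ℝ → Plane} {s : ℕ → ℝ}
    {ν : Plane × Plane} (hU : ∀ n, U n 0 = ν.1) (hW : ∀ n, W n 0 = ν.2)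
    (h : ∀ n, Orbit G ε (Icc 0 (s n)) (U n) (W n)) :
    ∃ u v : ℝ → Plane, Orbit G ε (⋃ n, Ico 0 (s n)) u v ∧
      ∀ n, ∀ t ∈ Ico 0 (s n), u t = U n t ∧ v t = W n t := by
  obtain ⟨x, hx, hxy⟩ := exists_isIntegralCurveOn_iUnion_Ico isOpen_phaseDomain
    (contDiffOn_phaseField hG) (y := fun n t => (ε, U n t, W n t)) (x₀ := (ε, ν))
    (fun n => by simp [hU, hW]) (fun n => (h n).isIntegralCurveOn) (fun n => (h n).pos)
  refine ⟨_, _, of_curve hx (fun t ht => ?_) fun t ht => ?_, fun n t ht => ?_⟩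
  · obtain ⟨n, hn⟩ := mem_iUnion.1 ht
    rw [hxy n hn]
  · obtain ⟨n, hn⟩ := mem_iUnion.1 ht
    rw [hxy n hn]
    exact (h n).pos t (Ico_subset_Icc_self hn)
  · rw [hxy n ht]
    exact ⟨rfl, rfl⟩

theorem glue {J : Set ℝ} {u' v' : ℝ → Plane} {a : ℝ} (h : Orbit G ε I u v)
    (h' : Orbit G ε J u' v') (hI : I ⊆ Iic a) (hJ : J ⊆ Ici a) (haI : a ∈ I) (haJ : a ∈ J)
    (hu : u a = u' a) (hv : v a = v' a) :
    Orbit G ε (I ∪ J) (fun t => if t < a then u t else u' t)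
      (fun t => if t < a then v t else v' t) := by
  have h1 := h.isIntegralCurveOn.glue h'.isIntegralCurveOn hI hJ haI haJ (by simp [hu, hv])
  have h2 : (fun t => if t < a then (ε, u t, v t) else (ε, u' t, v' t)) =
      fun t => (ε, if t < a then u t else u' t, if t < a then v t else v' t) := by
    funext t
    split_ifs <;> rfl
  rw [h2] at h1
  refine of_curve h1 (fun _ _ => rfl) fun t ht => ?_
  change 0 < ‖_‖ ^ 2 + ε ^ 2
  split_ifs with hta
  · exact h.pos t (ht.resolve_right fun h => (hJ h).not_gt hta)
  · refine h'.pos t (ht.elim (fun h => ?_) id)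
    rwa [le_antisymm (hI h) (not_lt.1 hta)]

/-- Time reversal composed with a linear isometry maps trajectories to trajectories. -/
theorem reflect (h : Orbit G ε I u v) (A : Plane →ₗᵢ[ℝ] Plane) (c : ℝ) {J : Set ℝ}
    (hJ : ∀ t ∈ J, c - t ∈ I) :
    Orbit G ε J (fun t => A (u (c - t))) (fun t => -A (v (c - t))) := by
  have hc : ∀ t, HasDerivWithinAt (fun t : ℝ => c - t) (-1) J t := fun t => by
    simpa using (hasDerivWithinAt_id t J).const_sub c
  have hA : ∀ (w : ℝ → Plane) (w' : Plane) t, HasDerivWithinAt w w' J t →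
      HasDerivWithinAt (fun t => A (w t)) (A w') J t := fun w w' t hw =>
    A.toContinuousLinearMap.hasFDerivAt.comp_hasDerivWithinAt t hw
  refine ⟨fun t ht => ?_, fun t ht => ?_, fun t ht => ?_⟩
  · simpa using h.pos _ (hJ t ht)
  · have := hA _ _ t ((h.deriv_fst _ (hJ t ht)).scomp t (hc t) hJ)
    simpa using this
  · have := (hA _ _ t ((h.deriv_snd _ (hJ t ht)).scomp t (hc t) hJ)).neg
    simp only [neg_smul, one_smul, map_neg, neg_neg, map_smul] at this
    simpa using! this

theorem shift (h : Orbit G ε I u v) (c : ℝ) {J : Set ℝ} (hJ : ∀ t ∈ J, t - c ∈ I) :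
    Orbit G ε J (fun t => u (t - c)) (fun t => v (t - c)) := by
  have hc : ∀ t, HasDerivWithinAt (fun t : ℝ => t - c) 1 J t := fun t =>
    (hasDerivWithinAt_id t J).sub_const c
  refine ⟨fun t ht => h.pos _ (hJ t ht), fun t ht => ?_, fun t ht => ?_⟩
  · simpa using! (h.deriv_fst _ (hJ t ht)).scomp t (hc t) hJ
  · simpa using! (h.deriv_snd _ (hJ t ht)).scomp t (hc t) hJ

end Orbit

/-! ### Reduction of the gradient equations to the central field; energy and angular momentum. -/

/-- The coefficient `V'(√σ) / √σ` of the central field `∇ V(|u|)` as a function of `σ = |u|²`. -/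
noncomputable def centralCoeff (V : ℝ → ℝ) (σ : ℝ) : ℝ := deriv V (√σ) / √σ

section Potential

variable {V : ℝ → ℝ}

theorem contDiffOn_centralCoeff (hV : ContDiffOn ℝ ∞ V (Ioi 0)) :
    ContDiffOn ℝ 1 (centralCoeff V) (Ioi 0) := by
  have h1 : ContDiffOn ℝ 1 (deriv V) (Ioi 0) := hV.deriv_of_isOpen isOpen_Ioi (right_eq_inf.mp rfl)
  have h2 : ContDiffOn ℝ 1 (fun σ : ℝ => √σ) (Ioi 0) := fun σ hσ =>
    (Real.contDiffAt_sqrt (ne_of_gt hσ)).contDiffWithinAt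
  exact (h1.comp h2 fun σ hσ => Real.sqrt_pos.2 hσ).div h2 fun σ hσ => (Real.sqrt_pos.2 hσ).ne'

theorem hasDerivAt_of_contDiffOn (hV : ContDiffOn ℝ ∞ V (Ioi 0)) {x : ℝ} (hx : 0 < x) :
    HasDerivAt V (deriv V x) x :=
  ((hV.differentiableOn (by simp)).differentiableAt (Ioi_mem_nhds hx)).hasDerivAt

theorem hasDerivAt_comp_sqrt (hV : ContDiffOn ℝ ∞ V (Ioi 0)) {σ : ℝ} (hσ : 0 < σ) :
    HasDerivAt (fun σ => V (√σ)) (centralCoeff V σ / 2) σ := by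
  have h := (hasDerivAt_of_contDiffOn hV (Real.sqrt_pos.2 hσ)).comp σ
    (Real.hasDerivAt_sqrt hσ.ne')
  convert! h using 1
  rw [centralCoeff]
  field_simp

theorem gradient_smoothed (hV : ContDiffOn ℝ ∞ V (Ioi 0)) {ε : ℝ} {u : Plane}
    (h : 0 < ‖u‖ ^ 2 + ε ^ 2) :
    gradient (fun y : Plane => smoothed V ε ‖y‖) u = centralCoeff V (‖u‖ ^ 2 + ε ^ 2) • u := by
  have h1 : HasFDerivAt (fun y : Plane => ‖y‖ ^ 2 + ε ^ 2) (2 • innerSL ℝ u) u :=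
    (hasStrictFDerivAt_norm_sq u).hasFDerivAt.add_const _
  have h2 := (hasDerivAt_comp_sqrt hV h).comp_hasFDerivAt u h1
  refine HasGradientAt.gradient ?_
  rw [hasGradientAt_iff_hasFDerivAt]
  convert! h2 using 1
  ext y
  simp
  ring

theorem smoothed_zero_norm (y : Plane) : smoothed V 0 ‖y‖ = V ‖y‖ := by
  simp [smoothed]

/-- Away from the singularity the singular problem is the case `ε = 0` of the smoothed one, so both
are treated as orbits of one field. -/
theorem solvesIVP_iff_orbit (hV : ContDiffOn ℝ ∞ V (Ioi 0)) {ε : ℝ} {ν : Plane × Plane}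
    {I : Set ℝ} {u : ℝ → Plane} (h : ∀ t ∈ I, 0 < ‖u t‖ ^ 2 + ε ^ 2) :
    SolvesIVP (gradient fun y : Plane => smoothed V ε ‖y‖) ν I u ↔
      ∃ v : ℝ → Plane, u 0 = ν.1 ∧ v 0 = ν.2 ∧ Orbit (centralCoeff V) ε I u v := by
  refine exists_congr fun v => and_congr_right fun _ => and_congr_right fun _ =>
    ⟨fun H => ⟨h, fun t ht => (H t ht).1, fun t ht => ?_⟩, fun H t ht =>
      ⟨H.deriv_fst t ht, ?_⟩⟩
  · rw [← gradient_smoothed hV (h t ht)]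
    exact (H t ht).2
  · rw [gradient_smoothed hV (h t ht)]
    exact H.deriv_snd t ht

theorem isClassicalSolution_iff_orbit (hV : ContDiffOn ℝ ∞ V (Ioi 0)) {ν : Plane × Plane}
    {I : Set ℝ} {u : ℝ → Plane} :
    IsClassicalSolution V ν I u ↔
      ∃ v : ℝ → Plane, u 0 = ν.1 ∧ v 0 = ν.2 ∧ Orbit (centralCoeff V) 0 I u v := by
  have h0 : (fun y : Plane => V ‖y‖) = fun y => smoothed V 0 ‖y‖ :=
    funext fun y => (smoothed_zero_norm y).symm
  rw [IsClassicalSolution, h0]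
  constructor
  · rintro ⟨h1, h2⟩
    exact (solvesIVP_iff_orbit hV fun t ht => by have := norm_pos_iff.2 (h2 t ht); positivity).1 h1
  · rintro ⟨v, hu, hv, h⟩
    refine ⟨(solvesIVP_iff_orbit hV h.pos).2 ⟨v, hu, hv, h⟩, fun t ht hut => ?_⟩
    have := h.pos t ht
    simp [hut] at this

theorem isRegularizedSolution_iff_orbit (hV : ContDiffOn ℝ ∞ V (Ioi 0)) {ν : Plane × Plane}
    {I : Set ℝ} {u : ℝ → Plane} {ε : ℝ} (hε : 0 < ε) :
    IsRegularizedSolution V ε ν I u ↔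
      ∃ v : ℝ → Plane, u 0 = ν.1 ∧ v 0 = ν.2 ∧ Orbit (centralCoeff V) ε I u v :=
  solvesIVP_iff_orbit hV fun t _ => by positivity

/-- The energy of a state of the (smoothed) problem. -/
noncomputable def energy (V : ℝ → ℝ) (ε : ℝ) (u v : Plane) : ℝ :=
  ‖v‖ ^ 2 / 2 - V (√(‖u‖ ^ 2 + ε ^ 2))

/-- The angular momentum. -/
def angMom (u v : Plane) : ℝ := u 0 * v 1 - u 1 * v 0

theorem real_inner_eq (u v : Plane) : inner ℝ u v = u 0 * v 0 + u 1 * v 1 := by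
  simp [PiLp.inner_apply, Fin.sum_univ_two]
  ring

theorem norm_sq_eq (u : Plane) : ‖u‖ ^ 2 = u 0 ^ 2 + u 1 ^ 2 := by
  simp [EuclideanSpace.norm_sq_eq, Fin.sum_univ_two]

theorem inner_sq_add_angMom_sq (u v : Plane) :
    inner ℝ u v ^ 2 + angMom u v ^ 2 = ‖u‖ ^ 2 * ‖v‖ ^ 2 := by
  rw [real_inner_eq, norm_sq_eq, norm_sq_eq, angMom]
  ring

namespace Orbit

variable {G : ℝ → ℝ} {ε : ℝ} {I : Set ℝ} {u v : ℝ → Plane}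

theorem hasDerivWithinAt_norm_sq (h : Orbit G ε I u v) {t : ℝ} (ht : t ∈ I) :
    HasDerivWithinAt (fun t => ‖u t‖ ^ 2) (2 * inner ℝ (u t) (v t)) I t :=
  (h.deriv_fst t ht).norm_sq

theorem hasDerivWithinAt_inner (h : Orbit G ε I u v) {t : ℝ} (ht : t ∈ I) :
    HasDerivWithinAt (fun t => inner ℝ (u t) (v t))
      (‖v t‖ ^ 2 + G (‖u t‖ ^ 2 + ε ^ 2) * ‖u t‖ ^ 2) I t := by
  have := (h.deriv_fst t ht).inner ℝ (h.deriv_snd t ht)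
  convert! this using 1
  rw [inner_smul_right, real_inner_self_eq_norm_sq, real_inner_self_eq_norm_sq]
  ring

theorem energy_eq (hV : ContDiffOn ℝ ∞ V (Ioi 0)) {τ : ℝ}
    (h : Orbit (centralCoeff V) ε (Icc 0 τ) u v) :
    ∀ t ∈ Icc 0 τ, energy V ε (u t) (v t) = energy V ε (u 0) (v 0) := by
  have hd : ∀ t ∈ Icc 0 τ,
      HasDerivWithinAt (fun t => energy V ε (u t) (v t)) 0 (Icc 0 τ) t := by
    intro t ht
    have h1 := (h.deriv_snd t ht).norm_sq.div_const 2
    have h2 := (hasDerivAt_comp_sqrt hV (h.pos t ht)).comp_hasDerivWithinAt t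
      ((h.hasDerivWithinAt_norm_sq ht).add_const (ε ^ 2))
    convert! h1.sub h2 using 1
    rw [inner_smul_right, real_inner_comm]
    ring
  exact constant_of_has_deriv_right_zero (fun t ht => (hd t ht).continuousWithinAt)
    fun t ht => hasDerivWithinAt_Ici_of_Icc (hd t (Ico_subset_Icc_self ht)) ht

theorem angMom_eq {τ : ℝ} (h : Orbit G ε (Icc 0 τ) u v) :
    ∀ t ∈ Icc 0 τ, angMom (u t) (v t) = angMom (u 0) (v 0) := by
  have hc : ∀ (w : ℝ → Plane) (w' : Plane) (i : Fin 2) t, HasDerivWithinAt w w' (Icc 0 τ) t →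
      HasDerivWithinAt (fun t => w t i) (w' i) (Icc 0 τ) t := fun w w' i t hw =>
    (EuclideanSpace.proj i : Plane →L[ℝ] ℝ).hasFDerivAt.comp_hasDerivWithinAt t hw
  have hd : ∀ t ∈ Icc 0 τ, HasDerivWithinAt (fun t => angMom (u t) (v t)) 0 (Icc 0 τ) t := by
    intro t ht
    have h1 := h.deriv_fst t ht
    have h2 := h.deriv_snd t ht
    convert! ((hc _ _ 0 t h1).mul (hc _ _ 1 t h2)).sub ((hc _ _ 1 t h1).mul (hc _ _ 0 t h2))
      using 1
    simp
    ring
  exact constant_of_has_deriv_right_zero (fun t ht => (hd t ht).continuousWithinAt)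
    fun t ht => hasDerivWithinAt_Ici_of_Icc (hd t (Ico_subset_Icc_self ht)) ht

end Orbit

/-! ### Slow growth of the potential at the singularity. -/

/-- On `(0, r]` the potential is decreasing, at least `B`, and `-x V'(x) ≤ κ V(x)`. -/
structure SlowNearZero (V : ℝ → ℝ) (κ B r : ℝ) : Prop where
  radius_pos : 0 < r
  deriv_neg : ∀ x ∈ Ioc 0 r, deriv V x < 0
  le_apply : ∀ x ∈ Ioc 0 r, B ≤ V x
  neg_mul_deriv_le : ∀ x ∈ Ioc 0 r, -(x * deriv V x) ≤ κ * V x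

/-- By convexity `-(x / 2) V'(x) ≤ V(x / 2) - V(x)`. Homogeneity at the ratio `2` bounds this
difference by `(κ / 4) V(x / 2)` and gives `V(x / 2) ≤ 2 V(x)`. -/
theorem ClassVStar.exists_slowNearZero (hV : ClassVStar V) {κ : ℝ} (hκ : 0 < κ) (B : ℝ) :
    ∃ r, SlowNearZero V κ B r := by
  obtain ⟨S, hS, hconv⟩ := hV.convex_near_zero
  obtain ⟨s, hs0, hsS⟩ : ∃ s : ℝ, 0 < s ∧ (s : EReal) < S := by
    obtain ⟨s, h1, h2⟩ := EReal.lt_iff_exists_real_btwn.1 hS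
    exact ⟨s, by exact_mod_cast h1, h2⟩
  have hmem : ∀ x ∈ Ioc 0 s, x ∈ openInterval S := fun x hx =>
    ⟨hx.1, lt_of_le_of_lt (by exact_mod_cast hx.2) hsS⟩
  have hunif := Metric.tendstoUniformlyOn_iff.1 (hV.zero_homogeneous 2 one_le_two)
  have hev : ∀ᶠ x in 𝓝[>] (0 : ℝ), dist 1 (V (x * 2) / V x) < min (κ / 4) (1 / 2) := by
    filter_upwards [hunif (min (κ / 4) (1 / 2)) (by positivity)] with x hx
    exact hx 2 ⟨one_le_two, le_rfl⟩
  have hbig : ∀ᶠ x in 𝓝[>] (0 : ℝ), max B 1 ≤ V x := hV.singular.eventually_ge_atTop _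
  obtain ⟨r, hr0, hr⟩ := mem_nhdsGT_iff_exists_Ioc_subset.1 (hev.and hbig)
  refine ⟨min r s, lt_min hr0 hs0, ?_, ?_, ?_⟩ <;> intro x hx
  · exact hconv.deriv_neg x (hmem x ⟨hx.1, hx.2.trans (min_le_right _ _)⟩)
  · exact (le_max_left _ _).trans (hr ⟨hx.1, hx.2.trans (min_le_left _ _)⟩).2
  · have hx0 : 0 < x := hx.1
    have hxs : x ≤ s := hx.2.trans (min_le_right _ _)
    have hxr : x ≤ r := hx.2.trans (min_le_left _ _)
    obtain ⟨hq, -⟩ := hr (show x / 2 ∈ Ioc 0 r from ⟨by positivity, by linarith⟩)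
    obtain ⟨-, hV1⟩ := hr (show x ∈ Ioc 0 r from ⟨hx0, hxr⟩)
    obtain ⟨-, hV2⟩ := hr (show x / 2 ∈ Ioc 0 r from ⟨by positivity, by linarith⟩)
    have hV1' : 1 ≤ V x := (le_max_right _ _).trans hV1
    have hV2' : 1 ≤ V (x / 2) := (le_max_right _ _).trans hV2
    obtain ⟨ξ, hξ, hξd⟩ := exists_deriv_eq_slope V (show x / 2 < x by linarith)
      (fun y hy => (hasDerivAt_of_contDiffOn hV.smooth
        (by linarith [hy.1] : (0 : ℝ) < y)).continuousAt.continuousWithinAt)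
      (fun y hy => (hasDerivAt_of_contDiffOn hV.smooth
        (by linarith [hy.1] : (0 : ℝ) < y)).differentiableAt.differentiableWithinAt)
    have hmono : deriv V ξ ≤ deriv V x := by
      have hmon : MonotoneOn (deriv V) (Ioc 0 s) := by
        have hd : ∀ y ∈ Ioi (0 : ℝ), DifferentiableAt ℝ (deriv V) y := fun y hy =>
          ((hV.smooth.deriv_of_isOpen (m := 1) isOpen_Ioi (right_eq_inf.mp rfl)).differentiableOn
            (by simp)).differentiableAt (Ioi_mem_nhds hy)
        refine monotoneOn_of_deriv_nonneg (convex_Ioc 0 s)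
          (fun y hy => (hd y hy.1).continuousAt.continuousWithinAt)
          (fun y hy => (hd y (interior_subset hy).1).differentiableWithinAt)
          fun y hy => (hconv.deriv2_pos y (hmem y (interior_subset hy))).le
      exact hmon ⟨by linarith [hξ.1], hξ.2.le.trans hxs⟩ ⟨hx0, hxs⟩ hξ.2.le
    rw [hξd, div_le_iff₀ (by linarith)] at hmono
    rw [Real.dist_eq, abs_lt] at hq
    rw [div_mul_cancel₀ x two_ne_zero] at hq
    have hle1 := hq.2.trans_le (min_le_left _ _)
    have hle2 := hq.2.trans_le (min_le_right _ _)
    have h3 : V (x / 2) - V x ≤ κ / 4 * V (x / 2) := by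
      have : 1 - κ / 4 ≤ V x / V (x / 2) := by linarith
      rw [le_div_iff₀ (by linarith)] at this
      linarith
    have h4 : V (x / 2) ≤ 2 * V x := by
      have : 1 / 2 ≤ V x / V (x / 2) := by linarith
      rw [le_div_iff₀ (by linarith)] at this
      linarith
    nlinarith

theorem SlowNearZero.antitoneOn {κ B r : ℝ} (h : SlowNearZero V κ B r)
    (hV : ContDiffOn ℝ ∞ V (Ioi 0)) : AntitoneOn V (Ioc 0 r) :=
  antitoneOn_of_deriv_nonpos (convex_Ioc 0 r)
    (fun _ hx => (hasDerivAt_of_contDiffOn hV hx.1).continuousAt.continuousWithinAt)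
    (fun _ hx => (hasDerivAt_of_contDiffOn hV
      (interior_subset hx).1).differentiableAt.differentiableWithinAt)
    fun x hx => (h.deriv_neg x (interior_subset hx)).le

/-- The derivative `V + x V'` of `x V` is at least `(1 - κ) V ≥ 0`. -/
theorem SlowNearZero.mul_apply_le {κ B r : ℝ} (h : SlowNearZero V κ B r)
    (hV : ContDiffOn ℝ ∞ V (Ioi 0)) (hκ : κ ≤ 1) (hB : 0 ≤ B) {x : ℝ} (hx : x ∈ Ioc 0 r) :
    x * V x ≤ r * V r := by
  have hd : ∀ y ∈ Ioi (0 : ℝ), HasDerivAt (fun y => y * V y) (1 * V y + y * deriv V y) y :=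
    fun y hy => (hasDerivAt_id y).mul (hasDerivAt_of_contDiffOn hV hy)
  have hmono : MonotoneOn (fun y => y * V y) (Ioc 0 r) := by
    refine monotoneOn_of_deriv_nonneg (convex_Ioc 0 r)
      (fun y hy => (hd y hy.1).continuousAt.continuousWithinAt)
      (fun y hy => (hd y (interior_subset hy).1).differentiableAt.differentiableWithinAt)
      fun y hy => ?_
    have hy' := interior_subset hy
    rw [(hd y hy'.1).deriv]
    have h1 := h.neg_mul_deriv_le y hy'
    have h2 := h.le_apply y hy'
    nlinarith
  exact hmono hx ⟨h.radius_pos, le_rfl⟩ hx.2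

end Potential

/-- A continuous function which starts negative and never vanishes at the end of an interval of
negativity stays negative. -/
theorem forall_lt_zero_of_ne_zero {f : ℝ → ℝ} {s : ℝ} (hf : ContinuousOn f (Icc 0 s))
    (h0 : f 0 < 0) (H : ∀ t ∈ Icc 0 s, (∀ r ∈ Ico 0 t, f r < 0) → f t ≠ 0) :
    ∀ t ∈ Icc 0 s, f t < 0 := by
  by_contra! hne
  obtain ⟨t₁, ht₁, hft₁⟩ := hne
  have hcl : IsCompact (Icc 0 s ∩ f ⁻¹' Ici 0) :=
    isCompact_Icc.of_isClosed_subset (hf.preimage_isClosed_of_isClosed isClosed_Icc isClosed_Ici)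
      inter_subset_left
  obtain ⟨t, ⟨ht, ht0⟩, hmin⟩ := hcl.exists_isLeast ⟨t₁, ht₁, hft₁⟩
  have hneg : ∀ r ∈ Ico 0 t, f r < 0 := fun r hr => by
    by_contra h
    exact absurd (hmin ⟨⟨hr.1, hr.2.le.trans ht.2⟩, not_lt.1 h⟩) (not_le.2 hr.2)
  obtain ⟨c, hc, hc0⟩ := intermediate_value_Icc ht.1 (hf.mono (Icc_subset_Icc_right ht.2))
    ⟨h0.le, ht0⟩
  have hct : c = t := le_antisymm hc.2 (hmin ⟨⟨hc.1, hc.2.trans ht.2⟩, hc0.ge⟩)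
  exact H t ht hneg (hct ▸ hc0)

/-! ### Estimates for motion near the centre. -/

/-- A state at distance at most `r` from the centre, with energy at most `E₀` in absolute value. -/
structure NearCentre (V : ℝ → ℝ) (E₀ r ε : ℝ) (u v : Plane) : Prop where
  pos : 0 < ‖u‖ ^ 2 + ε ^ 2
  sqrt_le : √(‖u‖ ^ 2 + ε ^ 2) ≤ r
  energy_le : |energy V ε u v| ≤ E₀

section NearCentre

variable {V : ℝ → ℝ} {κ E₀ r ε : ℝ} {u v : Plane}

namespace NearCentre

theorem mem_Ioc (h : NearCentre V E₀ r ε u v) : √(‖u‖ ^ 2 + ε ^ 2) ∈ Ioc 0 r :=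
  ⟨Real.sqrt_pos.2 h.pos, h.sqrt_le⟩

/-- The threshold `2 E₀ + 2` is chosen for this: `‖v‖² ≥ 2 V - 2 E₀`, and one copy of `V` absorbs `2
E₀ + 2`. -/
theorem apply_add_two_le (h : NearCentre V E₀ r ε u v) (hS : SlowNearZero V κ (2 * E₀ + 2) r) :
    V (√(‖u‖ ^ 2 + ε ^ 2)) + 2 ≤ ‖v‖ ^ 2 := by
  have h1 := hS.le_apply _ h.mem_Ioc
  have h2 := (abs_le.1 h.energy_le).1
  rw [energy] at h2
  linarith

theorem one_le_norm (h : NearCentre V E₀ r ε u v) (hS : SlowNearZero V κ (2 * E₀ + 2) r)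
    (hE₀ : 0 ≤ E₀) : 1 ≤ ‖v‖ := by
  have h1 := hS.le_apply _ h.mem_Ioc
  have h2 := h.apply_add_two_le hS
  nlinarith [norm_nonneg v]

theorem coeff_neg (h : NearCentre V E₀ r ε u v) (hS : SlowNearZero V κ (2 * E₀ + 2) r) :
    centralCoeff V (‖u‖ ^ 2 + ε ^ 2) < 0 :=
  div_neg_of_neg_of_pos (hS.deriv_neg _ h.mem_Ioc) h.mem_Ioc.1

/-- With `x² = ‖u‖² + ε²` the coefficient is `x V'(x) / x²`, and `‖u‖² ≤ x²`. The force term in the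
derivative of `⟨u, v⟩` is thus at most the fraction `κ` of the kinetic term. -/
theorem neg_coeff_mul_le (h : NearCentre V E₀ r ε u v) (hS : SlowNearZero V κ (2 * E₀ + 2) r)
    (hκ : 0 ≤ κ) : -(centralCoeff V (‖u‖ ^ 2 + ε ^ 2) * ‖u‖ ^ 2) ≤ κ * ‖v‖ ^ 2 := by
  have h1 := hS.neg_mul_deriv_le _ h.mem_Ioc
  have h2 := h.apply_add_two_le hS
  have h3 := h.coeff_neg hS
  have h4 : √(‖u‖ ^ 2 + ε ^ 2) * deriv V (√(‖u‖ ^ 2 + ε ^ 2)) =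
      centralCoeff V (‖u‖ ^ 2 + ε ^ 2) * (‖u‖ ^ 2 + ε ^ 2) := by
    have h5 := h.mem_Ioc.1
    have h6 := Real.mul_self_sqrt h.pos.le
    rw [centralCoeff, div_mul_eq_mul_div, eq_div_iff h5.ne']
    linear_combination deriv V (√(‖u‖ ^ 2 + ε ^ 2)) * h6
  rw [h4] at h1
  nlinarith [sq_nonneg ε]

theorem norm_sq_le (h : NearCentre V E₀ r ε u v) :
    ‖v‖ ^ 2 ≤ 2 * (E₀ + V (√(‖u‖ ^ 2 + ε ^ 2))) := by
  have h2 := (abs_le.1 h.energy_le).2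
  rw [energy] at h2
  linarith

end NearCentre

end NearCentre

theorem hasDerivWithinAt_normalize {v : ℝ → Plane} {w : Plane} {I : Set ℝ} {t : ℝ}
    (h : HasDerivWithinAt v w I t) (hv : v t ≠ 0) :
    HasDerivWithinAt (fun t => ‖v t‖⁻¹ • v t)
      (‖v t‖⁻¹ • w - (inner ℝ (v t) w / ‖v t‖ ^ 3) • v t) I t := by
  have h0 : 0 < ‖v t‖ := norm_pos_iff.2 hv
  have h1 : HasDerivWithinAt (fun t => √(‖v t‖ ^ 2)) (2 * inner ℝ (v t) w / (2 * √(‖v t‖ ^ 2))) I t :=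
    h.norm_sq.sqrt (by positivity)
  simp only [Real.sqrt_sq (norm_nonneg _)] at h1
  convert! (h1.inv h0.ne').smul h using 1
  rw [sub_eq_add_neg, ← neg_smul]
  congr 2
  field_simp

/-- The vector is the component of `w` orthogonal to `v`, divided by `‖v‖`. -/
theorem norm_deriv_normalize {v w : Plane} (hv : v ≠ 0) :
    ‖‖v‖⁻¹ • w - (inner ℝ v w / ‖v‖ ^ 3) • v‖ = |angMom w v| / ‖v‖ ^ 2 := by
  have h0 : 0 < ‖v‖ := norm_pos_iff.2 hv
  rw [← abs_of_nonneg (norm_nonneg (‖v‖⁻¹ • w - _)), ← abs_of_pos (pow_pos h0 2), ← abs_div,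
    ← sq_eq_sq_iff_abs_eq_abs, norm_sub_sq_real, norm_smul, norm_smul, inner_smul_left,
    inner_smul_right]
  have h1 := inner_sq_add_angMom_sq w v
  simp only [mul_pow, norm_inv, norm_div, norm_pow, conj_trivial, Real.norm_eq_abs,
    sq_abs, div_pow, abs_norm, real_inner_comm v w] at h1 ⊢
  field_simp
  linear_combination (-1 : ℝ) * h1

namespace Orbit

variable {V : ℝ → ℝ} {κ E₀ r ε s : ℝ} {u v : ℝ → Plane}

theorem norm_le_of_inner_neg {G : ℝ → ℝ} (h : Orbit G ε (Icc 0 s) u v)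
    (hneg : ∀ t ∈ Ico 0 s, inner ℝ (u t) (v t) < 0) :
    AntitoneOn (fun t => ‖u t‖) (Icc 0 s) := by
  have h1 : AntitoneOn (fun t => ‖u t‖ ^ 2) (Icc 0 s) := by
    refine antitoneOn_of_hasDerivWithinAt_nonpos (convex_Icc 0 s)
      (h.continuousOn_fst.norm.pow 2)
      (fun t ht => (h.hasDerivWithinAt_norm_sq (interior_subset ht)).mono interior_subset)
      fun t ht => ?_
    rw [interior_Icc] at ht
    have := hneg t (Ioo_subset_Ico_self ht)
    linarith
  exact fun a ha b hb hab => (sq_le_sq₀ (norm_nonneg _) (norm_nonneg _)).1 (h1 ha hb hab)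

theorem nearCentre_of_inner_neg (hV : ContDiffOn ℝ ∞ V (Ioi 0))
    (h : Orbit (centralCoeff V) ε (Icc 0 s) u v) (h0 : NearCentre V E₀ r ε (u 0) (v 0))
    (hneg : ∀ t ∈ Ico 0 s, inner ℝ (u t) (v t) < 0) :
    ∀ t ∈ Icc 0 s, NearCentre V E₀ r ε (u t) (v t) := fun t ht => by
  refine ⟨h.pos t ht, (Real.sqrt_le_sqrt ?_).trans h0.sqrt_le, ?_⟩
  · have := h.norm_le_of_inner_neg hneg (left_mem_Icc.2 (ht.1.trans ht.2)) ht ht.1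
    gcongr
  · rw [h.energy_eq hV t ht]
    exact h0.energy_le

/-- While the motion is inward the speed is at least `‖v 0‖`, so `⟨u, v⟩` increases at a rate of at
least `‖v 0‖² / 2`. It starts no lower than `-‖u 0‖ ‖v 0‖` and remains negative; finally `‖v 0‖ ≥
1`. -/
theorem length_le_of_inner_neg (hV : ContDiffOn ℝ ∞ V (Ioi 0)) (hκ : 0 ≤ κ) (hκ' : κ ≤ 1 / 2)
    (hE₀ : 0 ≤ E₀) (hS : SlowNearZero V κ (2 * E₀ + 2) r)
    (h : Orbit (centralCoeff V) ε (Icc 0 s) u v) (h0 : NearCentre V E₀ r ε (u 0) (v 0))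
    (hneg : ∀ t ∈ Ico 0 s, inner ℝ (u t) (v t) < 0) : s ≤ 2 * ‖u 0‖ := by
  have hnear := h.nearCentre_of_inner_neg hV h0 hneg
  refine le_of_forall_lt_imp_le_of_dense fun t hts => ?_
  rcases lt_or_ge t 0 with ht0 | ht0
  · exact ht0.le.trans (by positivity)
  have hmono : MonotoneOn (fun t => inner ℝ (u t) (v t) - ‖v 0‖ ^ 2 / 2 * t) (Icc 0 s) := by
    refine monotoneOn_of_hasDerivWithinAt_nonneg (convex_Icc 0 s)
      ((h.continuousOn_fst.inner h.continuousOn_snd).sub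
        (continuousOn_const.mul continuousOn_id))
      (fun t ht => ((h.hasDerivWithinAt_inner (interior_subset ht)).sub
        ((hasDerivWithinAt_id t _).const_mul _)).mono interior_subset) fun t ht => ?_
    have ht' := interior_subset ht
    have h1 := (hnear t ht').neg_coeff_mul_le hS hκ
    have h2 : ‖v 0‖ ^ 2 ≤ ‖v t‖ ^ 2 := by
      have h3 := h.energy_eq hV t ht'
      have h4 : V (√(‖u 0‖ ^ 2 + ε ^ 2)) ≤ V (√(‖u t‖ ^ 2 + ε ^ 2)) := by
        refine hS.antitoneOn hV (hnear t ht').mem_Ioc h0.mem_Ioc (Real.sqrt_le_sqrt ?_)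
        have := h.norm_le_of_inner_neg hneg (left_mem_Icc.2 (ht'.1.trans ht'.2)) ht' ht'.1
        gcongr
      simp only [energy] at h3
      linarith
    nlinarith [sq_nonneg ‖v t‖]
  have h1 := hmono (left_mem_Icc.2 (ht0.trans hts.le)) ⟨ht0, hts.le⟩ ht0
  have h2 := hneg t ⟨ht0, hts⟩
  have h3 := abs_real_inner_le_norm (u 0) (v 0)
  have h4 := h0.one_le_norm hS hE₀
  have h5 := (abs_le.1 h3).1
  simp only [mul_zero, sub_zero] at h1
  have h6 : ‖v 0‖ * (‖v 0‖ * t) ≤ ‖v 0‖ * (2 * ‖u 0‖) := by nlinarith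
  have h7 := le_of_mul_le_mul_left h6 (by linarith)
  nlinarith

/-- Near the centre the direction of the velocity hardly turns. -/
theorem dist_normalize_le (hκ : 0 ≤ κ) (hκ' : κ ≤ 1 / 2)
    (hE₀ : 0 ≤ E₀) (hS : SlowNearZero V κ (2 * E₀ + 2) r) (hs : 0 ≤ s)
    (h : Orbit (centralCoeff V) ε (Icc 0 s) u v)
    (hnear : ∀ t ∈ Icc 0 s, NearCentre V E₀ r ε (u t) (v t)) :
    ‖‖v s‖⁻¹ • v s - ‖v 0‖⁻¹ • v 0‖ ≤ 8 * κ := by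
  set ℓ := angMom (u 0) (v 0) with hℓ
  have hℓt : ∀ t ∈ Icc 0 s, angMom (u t) (v t) = ℓ := h.angMom_eq
  have hv0 : ∀ t ∈ Icc 0 s, v t ≠ 0 := fun t ht hvt => by
    have := (hnear t ht).one_le_norm hS hE₀
    simp [hvt] at this
    linarith
  set n : ℝ → Plane := fun t => ‖v t‖⁻¹ • v t with hn
  set n' : ℝ → Plane := fun t => ‖v t‖⁻¹ • (centralCoeff V (‖u t‖ ^ 2 + ε ^ 2) • u t) -
    (inner ℝ (v t) (centralCoeff V (‖u t‖ ^ 2 + ε ^ 2) • u t) / ‖v t‖ ^ 3) • v t with hn'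
  have hnd : ∀ t ∈ Icc 0 s, HasDerivWithinAt n (n' t) (Icc 0 s) t := fun t ht =>
    hasDerivWithinAt_normalize (h.deriv_snd t ht) (hv0 t ht)
  have hn'n : ∀ t ∈ Icc 0 s,
      ‖n' t‖ = -centralCoeff V (‖u t‖ ^ 2 + ε ^ 2) * |ℓ| / ‖v t‖ ^ 2 := by
    intro t ht
    rw [hn', norm_deriv_normalize (hv0 t ht), ← hℓt t ht,
      ← abs_of_neg ((hnear t ht).coeff_neg hS), ← abs_mul]
    congr 2
    simp [angMom]
    ring
  -- The arctangent measures the angle between position and velocity. Its derivative dominates the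
  -- turning rate of `v` up to the factor `2 κ`, and its total variation is less than `π` however
  -- small `ℓ` is.
  set b : ℝ → ℝ := fun t => 2 * κ * Real.arctan (inner ℝ (u t) (v t) / |ℓ|) with hb
  set b' : ℝ → ℝ := fun t => 2 * κ * (1 / (1 + (inner ℝ (u t) (v t) / |ℓ|) ^ 2) *
    ((‖v t‖ ^ 2 + centralCoeff V (‖u t‖ ^ 2 + ε ^ 2) * ‖u t‖ ^ 2) / |ℓ|)) with hb'
  have hbd : ∀ t ∈ Icc 0 s, HasDerivWithinAt b (b' t) (Icc 0 s) t := fun t ht =>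
    ((h.hasDerivWithinAt_inner ht).div_const _).arctan.const_mul _
  have hbound : ∀ t ∈ Icc 0 s, ‖n' t‖ ≤ b' t := by
    intro t ht
    rw [hn'n t ht]
    -- For `ℓ = 0` the direction is constant, and division by zero makes `b'` vanish too.
    rcases eq_or_ne ℓ 0 with h0 | h0
    · simp [hb', h0]
    have h1 := (hnear t ht).neg_coeff_mul_le hS hκ
    have h2 := inner_sq_add_angMom_sq (u t) (v t)
    rw [hℓt t ht] at h2
    have hℓ0 : 0 < |ℓ| := abs_pos.2 h0
    have hℓ2 : 0 < ℓ ^ 2 := by positivity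
    have hvp : 0 < ‖v t‖ ^ 2 := by have := norm_pos_iff.2 (hv0 t ht); positivity
    have hup : 0 < ‖u t‖ ^ 2 := by
      by_contra hneg
      have h3 : ‖u t‖ ^ 2 = 0 := le_antisymm (not_lt.1 hneg) (sq_nonneg _)
      rw [h3, zero_mul] at h2
      nlinarith [sq_nonneg (inner ℝ (u t) (v t))]
    have h4 : b' t = 2 * κ * (|ℓ| * (‖v t‖ ^ 2 + centralCoeff V (‖u t‖ ^ 2 + ε ^ 2) * ‖u t‖ ^ 2)
        / (‖u t‖ ^ 2 * ‖v t‖ ^ 2)) := by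
      have h5 : 1 + (inner ℝ (u t) (v t) / |ℓ|) ^ 2 = ‖u t‖ ^ 2 * ‖v t‖ ^ 2 / |ℓ| ^ 2 := by
        rw [← h2, sq_abs, div_pow, sq_abs]
        field_simp
        ring
      simp only [hb']
      rw [h5]
      field_simp
    rw [h4, ← mul_div_assoc, div_le_div_iff₀ hvp (by positivity)]
    -- The right side is at least `2 κ (1 - κ) ‖v‖²`, and `2 (1 - κ) ≥ 1`.
    have h6 : -(centralCoeff V (‖u t‖ ^ 2 + ε ^ 2) * ‖u t‖ ^ 2) ≤ 2 * κ *
        (‖v t‖ ^ 2 + centralCoeff V (‖u t‖ ^ 2 + ε ^ 2) * ‖u t‖ ^ 2) := by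
      have h7 := mul_le_mul_of_nonneg_left h1 (by positivity : 0 ≤ 2 * κ)
      have h8 := mul_nonneg (mul_nonneg hκ hvp.le) (by linarith : 0 ≤ 1 - 2 * κ)
      linarith
    have h7 := mul_le_mul_of_nonneg_right h6 (by positivity : 0 ≤ |ℓ| * ‖v t‖ ^ 2)
    linarith
  have hfin : ‖n s - n 0‖ ≤ b s - b 0 := by
    refine image_norm_le_of_norm_deriv_right_le_deriv_boundary' (f := fun t => n t - n 0)
      (f' := n') (a := 0) (b := s) (B := fun t => b t - b 0) (B' := b') ?_ ?_ (by simp) ?_ ?_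
      (fun t ht => hbound t (Ico_subset_Icc_self ht)) (right_mem_Icc.2 hs)
    · exact fun t ht => ((hnd t ht).sub_const _).continuousWithinAt
    · exact fun t ht => hasDerivWithinAt_Ici_of_Icc ((hnd t (Ico_subset_Icc_self ht)).sub_const _) ht
    · exact fun t ht => ((hbd t ht).sub_const _).continuousWithinAt
    · exact fun t ht => hasDerivWithinAt_Ici_of_Icc ((hbd t (Ico_subset_Icc_self ht)).sub_const _) ht
  have h1 := Real.arctan_lt_pi_div_two (inner ℝ (u s) (v s) / |ℓ|)
  have h2 := Real.neg_pi_div_two_lt_arctan (inner ℝ (u 0) (v 0) / |ℓ|)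
  have h3 := Real.pi_le_four
  refine hfin.trans ?_
  simp only [hb]
  nlinarith

end Orbit

/-! ### The alternative between pericentre and collision. -/

section NearCollision

variable {V : ℝ → ℝ} {κ E₀ r ε : ℝ}

theorem isCompact_annulus_prod_closedBall (a b M : ℝ) :
    IsCompact {x : Plane × Plane | a ≤ ‖x.1‖ ∧ ‖x.1‖ ≤ b ∧ ‖x.2‖ ^ 2 ≤ M} := by
  refine IsCompact.of_isClosed_subset ((isCompact_closedBall (0 : Plane) b).prod
    (isCompact_closedBall (0 : Plane) (√M))) ?_ fun x hx => ?_
  · exact (isClosed_le continuous_const continuous_fst.norm).inter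
      ((isClosed_le continuous_fst.norm continuous_const).inter
        (isClosed_le (continuous_snd.norm.pow 2) continuous_const))
  · exact ⟨mem_closedBall_zero_iff.2 hx.2.1, mem_closedBall_zero_iff.2 (Real.le_sqrt_of_sq_le hx.2.2)⟩

/-- A lower bound on `‖u‖` bounds the speed, so the trajectory is confined to a compact set of
states. -/
theorem NearCentre.norm_sq_le_of_le {u v : Plane} (hV : ContDiffOn ℝ ∞ V (Ioi 0))
    (hS : SlowNearZero V κ (2 * E₀ + 2) r) (h : NearCentre V E₀ r ε u v) {a : ℝ} (ha : 0 ≤ a)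
    (haε : 0 < a ^ 2 + ε ^ 2) (hau : a ≤ ‖u‖) :
    ‖v‖ ^ 2 ≤ 2 * (E₀ + V (√(a ^ 2 + ε ^ 2))) := by
  have h1 : √(a ^ 2 + ε ^ 2) ≤ √(‖u‖ ^ 2 + ε ^ 2) := by gcongr
  have h2 := hS.antitoneOn hV ⟨Real.sqrt_pos.2 haε, h1.trans h.sqrt_le⟩ h.mem_Ioc h1
  linarith [h.norm_sq_le]

/-- A non-radial trajectory of the singular problem does not come arbitrarily close to the
centre. -/
theorem NearCentre.sq_angMom_le {u v : Plane} (hV : ContDiffOn ℝ ∞ V (Ioi 0)) (hκ : κ ≤ 1)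
    (hE₀ : 0 ≤ E₀) (hS : SlowNearZero V κ (2 * E₀ + 2) r) (h : NearCentre V E₀ r 0 u v) :
    angMom u v ^ 2 ≤ 4 * (r * V r) * ‖u‖ := by
  have h1 := h.norm_sq_le
  have h2 := hS.le_apply _ h.mem_Ioc
  have h3 := hS.mul_apply_le hV hκ (by linarith) h.mem_Ioc
  have h4 := inner_sq_add_angMom_sq u v
  simp only [ne_eq, OfNat.ofNat_ne_zero, not_false_eq_true, zero_pow, add_zero, norm_nonneg,
    Real.sqrt_sq] at h1 h2 h3
  have h5 : ‖u‖ ^ 2 * ‖v‖ ^ 2 ≤ ‖u‖ ^ 2 * (4 * V ‖u‖) := by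
    gcongr
    linarith
  have h6 := mul_le_mul_of_nonneg_right h3 (norm_nonneg u)
  nlinarith [sq_nonneg (inner ℝ u v)]

/-- An inward trajectory near the centre which is not a collision trajectory has a pericentre. -/
theorem exists_pericentre (hV : ContDiffOn ℝ ∞ V (Ioi 0)) (hκ : 0 ≤ κ) (hκ' : κ ≤ 1 / 2)
    (hE₀ : 0 ≤ E₀) (hS : SlowNearZero V κ (2 * E₀ + 2) r) {ν : Plane × Plane}
    (h0 : NearCentre V E₀ r ε ν.1 ν.2) (hin : inner ℝ ν.1 ν.2 < 0)
    (hne : ε ≠ 0 ∨ angMom ν.1 ν.2 ≠ 0) :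
    ∃ (s : ℝ) (u v : ℝ → Plane), 0 < s ∧ s ≤ 2 * ‖ν.1‖ ∧ u 0 = ν.1 ∧ v 0 = ν.2 ∧
      Orbit (centralCoeff V) ε (Icc 0 s) u v ∧ inner ℝ (u s) (v s) = 0 ∧ v s ≠ 0 ∧
      (∀ t ∈ Icc 0 s, ‖u t‖ ≤ ‖ν.1‖) ∧ ‖‖v s‖⁻¹ • v s - ‖ν.2‖⁻¹ • ν.2‖ ≤ 8 * κ := by
  -- The singularity is kept away by the angular momentum if `ε = 0`; if `ε ≠ 0`, already `a = 0`
  -- suffices.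
  obtain ⟨a, ha, haε, hau⟩ : ∃ a, 0 ≤ a ∧ 0 < a ^ 2 + ε ^ 2 ∧ ∀ u v : Plane,
      NearCentre V E₀ r ε u v → angMom u v = angMom ν.1 ν.2 → a ≤ ‖u‖ := by
    rcases eq_or_ne ε 0 with rfl | hε
    · have hℓ := hne.resolve_left (by simp)
      have hVr := hS.le_apply r ⟨hS.radius_pos, le_rfl⟩
      have hA : 0 < 4 * (r * V r) := by
        have := mul_pos hS.radius_pos (show 0 < V r by linarith)
        positivity
      refine ⟨angMom ν.1 ν.2 ^ 2 / (4 * (r * V r)), by positivity, by positivity,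
        fun u v h huv => ?_⟩
      rw [div_le_iff₀' hA, ← huv]
      exact h.sq_angMom_le hV (by linarith) hE₀ hS
    · exact ⟨0, le_rfl, by positivity, fun u v _ _ => norm_nonneg u⟩
  have hC := isCompact_annulus_prod_closedBall a ‖ν.1‖ (2 * (E₀ + V (√(a ^ 2 + ε ^ 2))))
  have hνC := hau _ _ h0 rfl
  obtain ⟨s, u, v, hs, hu, hv, horb, hneg, hz⟩ := Orbit.exists_until_zero
    (contDiffOn_centralCoeff hV) hC (ε := ε) (ν := ν) (φ := fun x => inner ℝ x.1 x.2)
    (τ := 2 * ‖ν.1‖)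
    (fun x hx => by have := pow_le_pow_left₀ ha hx.1 2; linarith) (by fun_prop)
    ⟨hνC, le_rfl, h0.norm_sq_le_of_le hV hS ha haε hνC⟩ hin (by positivity)
    (fun u v s hs hu hv horb hneg => by
      have h0' : NearCentre V E₀ r ε (u 0) (v 0) := by rwa [hu, hv]
      have hs' := right_mem_Icc.2 hs
      have hnear := horb.nearCentre_of_inner_neg hV h0' hneg s hs'
      have has := hau _ _ hnear (by rw [horb.angMom_eq s hs', hu, hv])
      refine ⟨⟨has, ?_, hnear.norm_sq_le_of_le hV hS ha haε has⟩, ?_⟩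
      · rw [← hu]
        exact horb.norm_le_of_inner_neg hneg (left_mem_Icc.2 hs) hs' hs
      · rw [← hu]
        exact horb.length_le_of_inner_neg hV hκ hκ' hE₀ hS h0' hneg)
  have h0' : NearCentre V E₀ r ε (u 0) (v 0) := by rwa [hu, hv]
  have hnear := horb.nearCentre_of_inner_neg hV h0' hneg
  refine ⟨s, u, v, hs, ?_, hu, hv, horb, hz, fun hvs => ?_, fun t ht => ?_, ?_⟩
  · rw [← hu]
    exact horb.length_le_of_inner_neg hV hκ hκ' hE₀ hS h0' hneg
  · have := (hnear s (right_mem_Icc.2 hs.le)).one_le_norm hS hE₀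
    rw [hvs, norm_zero] at this
    linarith
  · rw [← hu]
    exact horb.norm_le_of_inner_neg hneg (left_mem_Icc.2 hs.le) ht ht.1
  · rw [← hv]
    exact horb.dist_normalize_le hκ hκ' hE₀ hS hs.le hnear

/-- At a first zero of `⟨u, v⟩` the angular momentum also vanishes, so `‖u‖ ‖v‖ = 0`; but `u ≠ 0`
and `‖v‖ ≥ 1`. -/
theorem Orbit.inner_neg_of_angMom_eq_zero (hV : ContDiffOn ℝ ∞ V (Ioi 0)) (hE₀ : 0 ≤ E₀)
    (hS : SlowNearZero V κ (2 * E₀ + 2) r) {u v : ℝ → Plane} {s : ℝ}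
    (h : Orbit (centralCoeff V) 0 (Icc 0 s) u v) (h0 : NearCentre V E₀ r 0 (u 0) (v 0))
    (hin : inner ℝ (u 0) (v 0) < 0) (hℓ : angMom (u 0) (v 0) = 0) :
    ∀ t ∈ Icc 0 s, inner ℝ (u t) (v t) < 0 := by
  refine forall_lt_zero_of_ne_zero (h.continuousOn_fst.inner h.continuousOn_snd) hin
    fun t ht hneg hz => ?_
  have h1 := inner_sq_add_angMom_sq (u t) (v t)
  have h2 := (h.mono (Icc_subset_Icc_right ht.2)).nearCentre_of_inner_neg hV h0 hneg t
    (right_mem_Icc.2 ht.1)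
  have h3 := h2.one_le_norm hS hE₀
  have h4 := h.pos t ht
  rw [hz, h.angMom_eq t ht, hℓ] at h1
  have h5 : 0 < ‖u t‖ ^ 2 * ‖v t‖ ^ 2 := mul_pos (by simpa using h4) (by positivity)
  rw [← h1] at h5
  simp at h5

/-- A radial inward trajectory of the singular problem near the centre ends in a collision. -/
theorem exists_collision (hV : ContDiffOn ℝ ∞ V (Ioi 0)) (hκ : 0 ≤ κ) (hκ' : κ ≤ 1 / 2)
    (hE₀ : 0 ≤ E₀) (hS : SlowNearZero V κ (2 * E₀ + 2) r) {ν : Plane × Plane}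
    (h0 : NearCentre V E₀ r 0 ν.1 ν.2) (hin : inner ℝ ν.1 ν.2 < 0)
    (hℓ : angMom ν.1 ν.2 = 0) :
    ∃ (s : ℝ) (u v : ℝ → Plane), 0 < s ∧ s ≤ 2 * ‖ν.1‖ ∧ u 0 = ν.1 ∧ v 0 = ν.2 ∧
      Orbit (centralCoeff V) 0 (Ico 0 s) u v ∧ (∀ t ∈ Ico 0 s, ‖u t‖ ≤ ‖ν.1‖) ∧
      Tendsto u (𝓝[<] s) (𝓝 0) := by
  have hG := contDiffOn_centralCoeff hV
  have hν0 : 0 < ‖ν.1‖ := by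
    rw [norm_pos_iff]
    intro h
    simp [h] at hin
  set a : ℕ → ℝ := fun n => ‖ν.1‖ / (n + 2) with ha
  have ha0 : ∀ n, 0 < a n := fun n => by positivity
  have haν : ∀ n, a n < ‖ν.1‖ := fun n => by
    rw [ha, div_lt_iff₀ (by positivity)]
    nlinarith [(Nat.cast_nonneg n : (0 : ℝ) ≤ n)]
  have ha_lt : ∀ n, a (n + 1) < a n := fun n => by
    simp only [ha]
    gcongr
    simp
  have ha_tendsto : Tendsto a atTop (𝓝 0) :=
    tendsto_const_nhds.div_atTop (tendsto_atTop_add_const_right _ _ tendsto_natCast_atTop_atTop)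
  have hneg : ∀ (u v : ℝ → Plane) (s : ℝ), u 0 = ν.1 → v 0 = ν.2 →
      Orbit (centralCoeff V) 0 (Icc 0 s) u v → ∀ t ∈ Icc 0 s, inner ℝ (u t) (v t) < 0 :=
    fun u v s hu hv horb => horb.inner_neg_of_angMom_eq_zero hV hE₀ hS (by rwa [hu, hv])
      (by rwa [hu, hv]) (by rwa [hu, hv])
  have hlen : ∀ (u v : ℝ → Plane) (s : ℝ), u 0 = ν.1 → v 0 = ν.2 →
      Orbit (centralCoeff V) 0 (Icc 0 s) u v → s ≤ 2 * ‖ν.1‖ :=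
    fun u v s hu hv horb => by
      rw [← hu]
      exact horb.length_le_of_inner_neg hV hκ hκ' hE₀ hS (by rwa [hu, hv])
        fun t ht => hneg u v s hu hv horb t (Ico_subset_Icc_self ht)
  have hanti : ∀ (u v : ℝ → Plane) (s : ℝ), u 0 = ν.1 → v 0 = ν.2 →
      Orbit (centralCoeff V) 0 (Icc 0 s) u v → AntitoneOn (fun t => ‖u t‖) (Icc 0 s) :=
    fun u v s hu hv horb => horb.norm_le_of_inner_neg
      fun t ht => hneg u v s hu hv horb t (Ico_subset_Icc_self ht)
  have hex : ∀ n, ∃ (s : ℝ) (u v : ℝ → Plane), 0 < s ∧ u 0 = ν.1 ∧ v 0 = ν.2 ∧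
      Orbit (centralCoeff V) 0 (Icc 0 s) u v ∧ (∀ t ∈ Ico 0 s, a n - ‖u t‖ < 0) ∧
        a n - ‖u s‖ = 0 := by
    intro n
    refine Orbit.exists_until_zero hG
      (isCompact_annulus_prod_closedBall (a n) ‖ν.1‖ (2 * (E₀ + V (√(a n ^ 2 + 0 ^ 2)))))
      (ε := 0) (ν := ν) (φ := fun x => a n - ‖x.1‖) (τ := 2 * ‖ν.1‖) (fun x hx => ?_)
      (by fun_prop) ⟨(haν n).le, le_rfl, ?_⟩ (by have := haν n; linarith) (by positivity)
      fun u v s hs hu hv horb hfar => ?_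
    · have := pow_pos ((ha0 n).trans_le hx.1) 2
      positivity
    · exact h0.norm_sq_le_of_le hV hS (ha0 n).le (by have := ha0 n; positivity) (haν n).le
    · have hs' := right_mem_Icc.2 hs
      have hge : a n ≤ ‖u s‖ := by
        rcases hs.eq_or_lt with h | h
        · rw [← h, hu]
          exact (haν n).le
        · have hcont : ContinuousWithinAt (fun t => ‖u t‖) (Ico 0 s) s :=
            (horb.continuousOn_fst.norm s hs').mono Ico_subset_Icc_self
          have hcl : s ∈ closure (Ico 0 s) := by
            rw [closure_Ico h.ne]
            exact hs'
          exact isClosed_Ici.closure_subset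
            (hcont.mem_closure hcl (t := Ici (a n)) fun t ht => (sub_neg.1 (hfar t ht)).le)
      have hnear := horb.nearCentre_of_inner_neg (r := r) (E₀ := E₀) hV (by rwa [hu, hv])
        (fun t ht => hneg u v s hu hv horb t (Ico_subset_Icc_self ht)) s hs'
      refine ⟨⟨hge, ?_, hnear.norm_sq_le_of_le hV hS (ha0 n).le
        (by have := ha0 n; positivity) hge⟩, hlen u v s hu hv horb⟩
      rw [← hu]
      exact hanti u v s hu hv horb (left_mem_Icc.2 hs) hs' hs
  choose s U W hs hU hW horb hfar hend using hex
  have hbdd : BddAbove (range s) := ⟨2 * ‖ν.1‖, by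
    rintro _ ⟨n, rfl⟩
    exact hlen _ _ _ (hU n) (hW n) (horb n)⟩
  -- Otherwise, by uniqueness, the smaller radius `a (n + 1)` would be attained no later than the
  -- first time at radius `a n`.
  have hs_lt : ∀ n, s n < s (n + 1) := fun n => by
    by_contra hle
    rw [not_lt] at hle
    have h1 := ((horb n).mono (Icc_subset_Icc_right hle)).unique hG (horb (n + 1))
      ((hU n).trans (hU _).symm) ((hW n).trans (hW _).symm) _ (right_mem_Icc.2 (hs _).le)
    have h2 := hend (n + 1)
    rw [← h1.1] at h2
    rcases hle.eq_or_lt with h | h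
    · rw [h] at h2
      linarith [hend n, ha_lt n]
    · linarith [hfar n _ ⟨(hs (n + 1)).le, h⟩, ha_lt n]
  set T := ⨆ n, s n with hT
  have hsT : ∀ n, s n < T := fun n => (hs_lt n).trans_le (le_ciSup hbdd (n + 1))
  have hunion : ⋃ n, Ico 0 (s n) = Ico 0 T := by
    ext t
    simp only [mem_iUnion, mem_Ico]
    constructor
    · rintro ⟨n, h1, h2⟩
      exact ⟨h1, h2.trans (hsT n)⟩
    · rintro ⟨h1, h2⟩
      obtain ⟨n, hn⟩ := exists_lt_of_lt_ciSup h2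
      exact ⟨n, h1, hn⟩
  obtain ⟨u, v, huv, hagree⟩ := Orbit.exists_iUnion_Ico hG hU hW horb
  rw [hunion] at huv
  have hanti' : ∀ x y, 0 ≤ x → x ≤ y → y < T → ‖u y‖ ≤ ‖u x‖ := fun x y hx hxy hy => by
    obtain ⟨n, hn⟩ := exists_lt_of_lt_ciSup hy
    rw [(hagree n x ⟨hx, hxy.trans_lt hn⟩).1, (hagree n y ⟨hx.trans hxy, hn⟩).1]
    exact hanti _ _ _ (hU n) (hW n) (horb n) ⟨hx, hxy.trans hn.le⟩ ⟨hx.trans hxy, hn.le⟩ hxy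
  have h00 := hagree 0 0 ⟨le_rfl, hs 0⟩
  have hu0 : u 0 = ν.1 := h00.1.trans (hU 0)
  have hus : ∀ n, ‖u (s n)‖ = a n := fun n => by
    have h1 := ((horb (n + 1)).mono (Icc_subset_Icc_right (hs_lt n).le)).unique hG (horb n)
      ((hU _).trans (hU n).symm) ((hW _).trans (hW n).symm) (s n) (right_mem_Icc.2 (hs n).le)
    rw [(hagree (n + 1) (s n) ⟨(hs n).le, hs_lt n⟩).1, h1.1]
    linarith [hend n]
  refine ⟨T, u, v, (hs 0).trans (hsT 0), ?_, hu0, h00.2.trans (hW 0), huv, fun t ht => ?_, ?_⟩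
  · exact ciSup_le fun n => hlen _ _ _ (hU n) (hW n) (horb n)
  · rw [← hu0]
    exact hanti' 0 t le_rfl ht.1 ht.2
  · rw [tendsto_zero_iff_norm_tendsto_zero, Metric.tendsto_nhds]
    intro δ hδ
    obtain ⟨n, hn⟩ := (ha_tendsto.eventually (gt_mem_nhds hδ)).exists
    filter_upwards [Ico_mem_nhdsLT (hsT n)] with t ht
    rw [Real.dist_eq, sub_zero, abs_norm]
    exact (hanti' _ _ (hs n).le ht.1 ht.2).trans_lt ((hus n).trans_lt hn)

end NearCollision

/-! ### Reflections of the plane and the symmetry of trajectories. -/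

theorem angMom_comm_zero {x y : Plane} (h : angMom x y = 0) : angMom y x = 0 := by
  simp only [angMom] at *
  linarith

theorem angMom_self (x : Plane) : angMom x x = 0 := by
  simp only [angMom]
  ring

theorem angMom_smul_left (c : ℝ) (x y : Plane) : angMom (c • x) y = c * angMom x y := by
  simp [angMom]
  ring

theorem eq_inner_smul_of_angMom_eq_zero {x n : Plane} (hn : ‖n‖ = 1) (h : angMom x n = 0) :
    x = (inner ℝ n x : ℝ) • n := by
  have h1 := norm_sq_eq n
  rw [hn] at h1
  simp only [angMom] at h
  ext i
  fin_cases i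
  · simp [real_inner_eq]
    linear_combination x 0 * h1 + n 1 * h
  · simp [real_inner_eq]
    linear_combination x 1 * h1 - n 0 * h

/-- The reflection `x ↦ x - 2 ⟨n, x⟩ n` in the line orthogonal to `n`. -/
noncomputable def reflectAlong (n : Plane) : Plane →ₗᵢ[ℝ] Plane :=
  (Submodule.span ℝ {n})ᗮ.reflection.toLinearIsometry

theorem reflectAlong_apply {n : Plane} (hn : ‖n‖ = 1) (x : Plane) :
    reflectAlong n x = x - (2 * inner ℝ n x : ℝ) • n := by
  change (Submodule.span ℝ {n})ᗮ.reflection x = _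
  rw [Submodule.reflection_orthogonal_apply, Submodule.reflection_singleton_apply]
  simp [hn, two_mul, add_smul, two_smul]

theorem reflectAlong_of_angMom_eq_zero {n x : Plane} (hn : ‖n‖ = 1) (h : angMom x n = 0) :
    reflectAlong n x = -x := by
  rw [reflectAlong_apply hn, mul_smul, ← eq_inner_smul_of_angMom_eq_zero hn h, two_smul]
  abel

/-- For `n = m` the reflection sends `x` to `-x`, and it is Lipschitz in `n`. This is how reflection
at a pericentre turns into transmission in the limit. -/
theorem norm_reflectAlong_add_le {n m x : Plane} (hn : ‖n‖ = 1) (hm : ‖m‖ = 1)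
    (h : angMom x m = 0) : ‖reflectAlong n x + x‖ ≤ 4 * ‖x‖ * ‖n - m‖ := by
  have h1 : reflectAlong n x + x = reflectAlong n x - reflectAlong m x := by
    rw [reflectAlong_of_angMom_eq_zero hm h, sub_neg_eq_add]
  have h2 : reflectAlong n x - reflectAlong m x =
      (2 * inner ℝ m x : ℝ) • (m - n) + (2 * inner ℝ (m - n) x : ℝ) • n := by
    rw [reflectAlong_apply hn, reflectAlong_apply hm, inner_sub_left]
    module
  rw [h1, h2]
  refine (norm_add_le _ _).trans ?_
  rw [norm_smul, norm_smul, hn, norm_sub_rev n m, Real.norm_eq_abs, Real.norm_eq_abs, abs_mul,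
    abs_mul, abs_two]
  have h3 := abs_real_inner_le_norm m x
  have h4 := abs_real_inner_le_norm (m - n) x
  rw [hm] at h3
  nlinarith [norm_nonneg (m - n)]

namespace Orbit

variable {G : ℝ → ℝ} {ε : ℝ} {u v : ℝ → Plane}

/-- A trajectory with a pericentre at time `τ` is continued by its reflection. -/
theorem reflect_at_pericentre {τ : ℝ} (hτ : 0 < τ) (h : Orbit G ε (Icc 0 τ) u v)
    (hin : inner ℝ (u τ) (v τ) = 0) (hv : v τ ≠ 0) {n : Plane} (hn : n = ‖v τ‖⁻¹ • v τ) :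
    ∃ u' v' : ℝ → Plane, Orbit G ε (Icc 0 (2 * τ)) u' v' ∧ (∀ t ∈ Icc 0 τ, u' t = u t) ∧
      v' 0 = v 0 ∧ (∀ t ∈ Icc τ (2 * τ), u' t = reflectAlong n (u' (2 * τ - t))) ∧
      v' (2 * τ) = -reflectAlong n (v 0) := by
  have hv0 : ‖v τ‖ ≠ 0 := norm_ne_zero_iff.2 hv
  have hn1 : ‖n‖ = 1 := by rw [hn, norm_smul, norm_inv, norm_norm, inv_mul_cancel₀ hv0]
  -- At the pericentre `u` is orthogonal to `n` and `v` is parallel to it, so the reversed reflected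
  -- trajectory has the same position and velocity there.
  have hu_refl : reflectAlong n (u τ) = u τ := by
    rw [reflectAlong_apply hn1, hn, inner_smul_left, real_inner_comm, hin]
    simp
  have hv_refl : reflectAlong n (v τ) = -v τ := by
    refine reflectAlong_of_angMom_eq_zero hn1 ?_
    rw [hn]
    exact angMom_comm_zero (by rw [angMom_smul_left, angMom_self, mul_zero])
  have h2 := h.reflect (reflectAlong n) (2 * τ) (J := Icc τ (2 * τ))
    fun t ht => ⟨by linarith [ht.2], by linarith [ht.1]⟩
  have h2τ : 2 * τ - τ = τ := by ring
  have h3 := h.glue h2 (a := τ) (fun t ht => ht.2) (fun t ht => ht.1) ⟨hτ.le, le_rfl⟩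
    ⟨le_rfl, by linarith⟩ (by rw [h2τ, hu_refl]) (by rw [h2τ, hv_refl, neg_neg])
  rw [Icc_union_Icc_eq_Icc hτ.le (by linarith)] at h3
  have heq : ∀ t ∈ Icc 0 τ, (if t < τ then u t else reflectAlong n (u (2 * τ - t))) = u t := by
    intro t ht
    rcases ht.2.lt_or_eq with h | h
    · rw [if_pos h]
    · rw [if_neg h.not_lt, h, h2τ, hu_refl]
  refine ⟨_, _, h3, heq, if_pos hτ, fun t ht => ?_, ?_⟩
  · rw [heq (2 * τ - t) ⟨by linarith [ht.2], by linarith [ht.1]⟩]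
    exact if_neg (not_lt.2 ht.1)
  · simp [not_lt.2 (show τ ≤ 2 * τ by linarith)]

/-- Radial trajectories of the singular problem stay on a line through the centre. -/
theorem direction_eq_of_angMom_eq_zero {T : ℝ} (h : Orbit G 0 (Ico 0 T) u v)
    (hℓ : angMom (u 0) (v 0) = 0) :
    ∀ t ∈ Ico 0 T, ‖u t‖⁻¹ • u t = ‖u 0‖⁻¹ • u 0 ∧ angMom (u t) (u 0) = 0 := by
  intro t ht
  have hI := h.mono (show Icc 0 t ⊆ Ico 0 T from fun s hs => ⟨hs.1, hs.2.trans_lt ht.2⟩)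
  have hu0 : ∀ s ∈ Icc 0 t, u s ≠ 0 := fun s hs hus => by
    have := hI.pos s hs
    simp [hus] at this
  have hd : ∀ s ∈ Icc 0 t, HasDerivWithinAt (fun s => ‖u s‖⁻¹ • u s) 0 (Icc 0 t) s := by
    intro s hs
    have h1 := hasDerivWithinAt_normalize (hI.deriv_fst s hs) (hu0 s hs)
    have h2 := norm_deriv_normalize (w := v s) (hu0 s hs)
    rw [angMom_comm_zero ((hI.angMom_eq s hs).trans hℓ), abs_zero, zero_div, norm_eq_zero] at h2
    rwa [h2] at h1
  have h3 := constant_of_has_deriv_right_zero (fun s hs => (hd s hs).continuousWithinAt)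
    (fun s hs => hasDerivWithinAt_Ici_of_Icc (hd s (Ico_subset_Icc_self hs)) hs) t
    (right_mem_Icc.2 ht.1)
  have hut := hu0 t (right_mem_Icc.2 ht.1)
  have h4 : angMom (u t) (u 0) = 0 := by
    have h5 : u t = (‖u t‖ * ‖u 0‖⁻¹) • u 0 := by
      rw [mul_smul, ← h3, smul_smul, mul_inv_cancel₀ (norm_ne_zero_iff.2 hut), one_smul]
    rw [h5, angMom_smul_left, angMom_self, mul_zero]
  exact ⟨h3, h4⟩

end Orbit

/-! ### Collision trajectories, and comparison with the transmission solution. -/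

section Collision

variable {V : ℝ → ℝ} {u v : ℝ → Plane} {T : ℝ}

theorem Orbit.eventually_nearCentre (hV : ContDiffOn ℝ ∞ V (Ioi 0)) (hT : 0 < T)
    (h : Orbit (centralCoeff V) 0 (Ico 0 T) u v) (hlim : Tendsto u (𝓝[<] T) (𝓝 0))
    {E₀ r : ℝ} (hE₀ : |energy V 0 (u 0) (v 0)| ≤ E₀) (hr : 0 < r) :
    ∀ᶠ t in 𝓝[<] T, NearCentre V E₀ r 0 (u t) (v t) := by
  have hsmall : ∀ᶠ t in 𝓝[<] T, ‖u t‖ < r :=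
    (tendsto_zero_iff_norm_tendsto_zero.1 hlim).eventually (gt_mem_nhds hr)
  filter_upwards [hsmall, Ico_mem_nhdsLT hT] with t htr ht
  refine ⟨h.pos t ht, by simpa using htr.le, ?_⟩
  rwa [(h.mono (fun s hs => ⟨hs.1, hs.2.trans_lt ht.2⟩)).energy_eq hV t (right_mem_Icc.2 ht.1)]

/-- Collision trajectories are radial. -/
theorem ClassVStar.angMom_eq_zero_of_collision (hV : ClassVStar V) (hT : 0 < T)
    (h : Orbit (centralCoeff V) 0 (Ico 0 T) u v) (hlim : Tendsto u (𝓝[<] T) (𝓝 0)) :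
    angMom (u 0) (v 0) = 0 := by
  set E₀ := |energy V 0 (u 0) (v 0)| with hE₀
  obtain ⟨r, hS⟩ := hV.exists_slowNearZero one_pos (2 * E₀ + 2)
  have hnear := h.eventually_nearCentre hV.smooth hT hlim hE₀.ge hS.radius_pos
  have hlim' : Tendsto (fun t => 4 * (r * V r) * ‖u t‖) (𝓝[<] T) (𝓝 0) := by
    simpa using (tendsto_zero_iff_norm_tendsto_zero.1 hlim).const_mul (4 * (r * V r))
  have hle : angMom (u 0) (v 0) ^ 2 ≤ 0 := by
    refine ge_of_tendsto hlim' ?_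
    filter_upwards [hnear, Ico_mem_nhdsLT hT] with t h1 ht
    rw [← (h.mono (fun s hs => ⟨hs.1, hs.2.trans_lt ht.2⟩)).angMom_eq t (right_mem_Icc.2 ht.1)]
    exact h1.sq_angMom_le hV.smooth le_rfl (abs_nonneg _) hS
  exact pow_eq_zero_iff two_ne_zero |>.1 (le_antisymm hle (sq_nonneg _))

/-- A collision trajectory moves inwards shortly before the collision. -/
theorem Orbit.eventually_inner_neg (hV : ContDiffOn ℝ ∞ V (Ioi 0)) (hT : 0 < T)
    (h : Orbit (centralCoeff V) 0 (Ico 0 T) u v) (hlim : Tendsto u (𝓝[<] T) (𝓝 0))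
    {κ E₀ r : ℝ} (hκ : 0 ≤ κ) (hκ' : κ ≤ 1 / 2) (hE₀ : |energy V 0 (u 0) (v 0)| ≤ E₀)
    (hS : SlowNearZero V κ (2 * E₀ + 2) r) :
    ∀ᶠ t in 𝓝[<] T, inner ℝ (u t) (v t) < 0 := by
  obtain ⟨a, ha, hnear⟩ := mem_nhdsLT_iff_exists_Ico_subset.1
    ((h.eventually_nearCentre hV hT hlim hE₀ hS.radius_pos).and (Ico_mem_nhdsLT hT))
  filter_upwards [Ico_mem_nhdsLT ha] with t ht
  -- Since `⟨u, v⟩` increases near the centre, a nonnegative value persists up to `T`; then `‖u‖`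
  -- could not decrease to `0`.
  by_contra hge
  rw [not_lt] at hge
  have hsub : Ico t T ⊆ Ico 0 T := fun s hs => ⟨(hnear ht).2.1.trans hs.1, hs.2⟩
  have hint : interior (Ico t T) ⊆ Ico 0 T := interior_subset.trans hsub
  have hmono : MonotoneOn (fun s => inner ℝ (u s) (v s)) (Ico t T) := by
    refine monotoneOn_of_hasDerivWithinAt_nonneg (convex_Ico t T)
      ((h.continuousOn_fst.inner h.continuousOn_snd).mono hsub)
      (fun s hs => (h.hasDerivWithinAt_inner (hint hs)).mono hint) fun s hs => ?_
    have h1 := (hnear ⟨ht.1.trans (interior_subset hs).1, (interior_subset hs).2⟩).1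
    have h2 := h1.neg_coeff_mul_le hS hκ
    nlinarith [sq_nonneg ‖v s‖]
  have htt : t ∈ Ico t T := ⟨le_rfl, ht.2⟩
  have hmono2 : MonotoneOn (fun s => ‖u s‖ ^ 2) (Ico t T) := by
    refine monotoneOn_of_hasDerivWithinAt_nonneg (convex_Ico t T)
      ((h.continuousOn_fst.norm.pow 2).mono hsub)
      (fun s hs => (h.hasDerivWithinAt_norm_sq (hint hs)).mono hint) fun s hs => ?_
    have := hmono htt (interior_subset hs) (interior_subset hs).1
    have h3 : 0 ≤ inner ℝ (u s) (v s) := hge.trans this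
    linarith
  have hlim2 : Tendsto (fun s => ‖u s‖ ^ 2) (𝓝[<] T) (𝓝 0) := by
    simpa using (tendsto_zero_iff_norm_tendsto_zero.1 hlim).pow 2
  have hle : ‖u t‖ ^ 2 ≤ 0 := by
    refine ge_of_tendsto hlim2 ?_
    filter_upwards [Ico_mem_nhdsLT ht.2] with s hs
    exact hmono2 htt hs hs.1
  have := h.pos t (hsub htt)
  simp only [ne_eq, OfNat.ofNat_ne_zero, not_false_eq_true, zero_pow, add_zero] at this
  linarith

/-- The path stopped at the centre at time `T`, and constant before time `0`. -/
noncomputable def stoppedPath (T : ℝ) (u : ℝ → Plane) (t : ℝ) : Plane :=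
  if t < T then u (max t 0) else 0

/-- The path factors through the projection onto the compact interval `[0, T]`. -/
theorem uniformContinuous_stoppedPath (hT : 0 < T) (hu : ContinuousOn u (Ico 0 T))
    (hlim : Tendsto u (𝓝[<] T) (𝓝 0)) : UniformContinuous (stoppedPath T u) := by
  have hcont : ContinuousOn (stoppedPath T u) (Icc 0 T) := by
    intro t ht
    rcases ht.2.lt_or_eq with h | h
    · have h1 : ContinuousWithinAt u (Icc 0 T) t :=
        (hu t ⟨ht.1, h⟩).mono_of_mem_nhdsWithin (by
          filter_upwards [self_mem_nhdsWithin, mem_nhdsWithin_of_mem_nhds (Iio_mem_nhds h)]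
            with s hs hsT using ⟨hs.1, hsT⟩)
      refine h1.congr_of_eventuallyEq ?_ (by simp [stoppedPath, h, ht.1])
      filter_upwards [self_mem_nhdsWithin, mem_nhdsWithin_of_mem_nhds (Iio_mem_nhds h)]
        with s hs hsT
      simp [stoppedPath, mem_Iio.1 hsT, hs.1]
    · have h0 : stoppedPath T u t = 0 := by simp [stoppedPath, h]
      rw [ContinuousWithinAt, h0, h]
      rw [Metric.tendsto_nhds] at hlim ⊢
      intro δ hδ
      have h2 := hlim δ hδ
      rw [eventually_nhdsWithin_iff] at h2 ⊢
      filter_upwards [h2] with s hs hsI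
      rcases hsI.2.lt_or_eq with h3 | h3
      · simpa [stoppedPath, h3, hsI.1] using hs h3
      · simpa [stoppedPath, h3] using hδ
  have h1 : UniformContinuous ((Icc 0 T).domRestrict (stoppedPath T u)) :=
    CompactSpace.uniformContinuous_of_continuous hcont.domRestrict
  have h2 : ∀ t, stoppedPath T u t = stoppedPath T u (projIcc 0 T hT.le t) := by
    intro t
    rw [coe_projIcc]
    rcases le_or_gt T t with h | h
    · simp [stoppedPath, h, hT.le]
    · rcases le_or_gt 0 t with h' | h'
      · simp [stoppedPath, h, h', h.le]
      · simp [stoppedPath, h, h'.le, h.le, hT]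
  rw [show stoppedPath T u = (Icc 0 T).domRestrict (stoppedPath T u) ∘ projIcc 0 T hT.le from
    funext h2]
  exact h1.comp (LipschitzWith.projIcc hT.le).uniformContinuous

theorem stoppedPath_of_mem {t : ℝ} (ht : t ∈ Ico 0 T) : stoppedPath T u t = u t := by
  simp [stoppedPath, ht.1, ht.2]

theorem stoppedPath_of_ge {t : ℝ} (ht : T ≤ t) : stoppedPath T u t = 0 := by
  simp [stoppedPath, ht]

theorem stoppedPath_of_le (hT : 0 < T) {t : ℝ} (ht : t ≤ 0) : stoppedPath T u t = u 0 := by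
  simp [stoppedPath, ht, ht.trans_lt hT]

/-- At each time at least one of the two terms vanishes. The right side is continuous on all of `ℝ`,
which allows comparisons slightly beyond `2 T`. -/
theorem transmission_eq {t : ℝ} (ht : t ∈ Icc 0 (2 * T)) :
    transmission T u t = stoppedPath T u t - stoppedPath T u (2 * T - t) := by
  rcases lt_trichotomy t T with h | h | h
  · rw [stoppedPath_of_mem ⟨ht.1, h⟩, stoppedPath_of_ge (by linarith)]
    simp [transmission, h]
  · rw [stoppedPath_of_ge h.ge, stoppedPath_of_ge (by linarith)]
    simp [transmission, h]
  · rw [stoppedPath_of_ge h.le, stoppedPath_of_mem ⟨by linarith [ht.2], by linarith⟩]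
    simp [transmission, h.not_gt, h.ne']

/-- Comparison of a path which is symmetric with respect to the time `τ` with the transmission of
a path `z` stopped at a nearby time `T`. -/
theorem dist_transmission_lt {z Y : ℝ → Plane} {β θ τ : ℝ} (A : Plane →ₗᵢ[ℝ] Plane)
    (hz : ∀ a b, |a - b| ≤ 2 * θ → dist (z a) (z b) < β) (hz0 : ∀ t, T ≤ t → z t = 0)
    (hθ : |τ - T| ≤ θ) (hA : ∀ t, ‖A (z t) + z t‖ < β)
    (hY : ∀ t ∈ Icc 0 τ, dist (Y t) (z t) < 3 * β)
    (hYA : ∀ t ∈ Icc τ (2 * τ), Y t = A (Y (2 * τ - t))) :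
    ∀ t ∈ Icc 0 (2 * τ), dist (Y t) (z t - z (2 * T - t)) < 6 * β := by
  have hθ0 : 0 ≤ θ := (abs_nonneg _).trans hθ
  have hθ' := abs_le.1 hθ
  have hsmall : ∀ t, T - θ ≤ t → ‖z t‖ < β := by
    intro t ht
    have h1 := hz t (max t T) (by
      rw [abs_sub_comm, abs_of_nonneg (by linarith [le_max_left t T])]
      rcases max_cases t T with h | h <;> linarith)
    rwa [hz0 _ (le_max_right _ _), dist_zero_right] at h1
  intro t ht
  rcases le_total t τ with h | h
  · have h1 := hY t ⟨ht.1, h⟩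
    have h2 := hsmall (2 * T - t) (by linarith)
    have h3 : Y t - (z t - z (2 * T - t)) = (Y t - z t) + z (2 * T - t) := by abel
    have h4 := norm_add_le (Y t - z t) (z (2 * T - t))
    rw [dist_eq_norm] at h1 ⊢
    rw [h3]
    linarith [norm_nonneg (z (2 * T - t))]
  · have hs : 2 * τ - t ∈ Icc 0 τ := ⟨by linarith [ht.2], by linarith⟩
    have h1 := hY _ hs
    have h2 := hA (2 * τ - t)
    have h3 := hz (2 * T - t) (2 * τ - t) (by
      rw [show 2 * T - t - (2 * τ - t) = -(2 * (τ - T)) by ring, abs_neg, abs_mul, abs_two]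
      linarith)
    have h4 := hsmall t (by linarith)
    rw [dist_eq_norm] at h1 h3 ⊢
    rw [hYA t ⟨h, ht.2⟩]
    -- The errors are `3 β` for following `z`, and `β` each for `A` against `-1`, for `τ` against
    -- `T`, and for `z t`, which is nearly zero after `τ`.
    have h5 : A (Y (2 * τ - t)) - (z t - z (2 * T - t)) = A (Y (2 * τ - t) - z (2 * τ - t)) +
        (A (z (2 * τ - t)) + z (2 * τ - t)) + (z (2 * T - t) - z (2 * τ - t)) - z t := by
      rw [map_sub]
      abel
    rw [h5]
    have h6 := A.norm_map (Y (2 * τ - t) - z (2 * τ - t))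
    have h7 := norm_sub_le (A (Y (2 * τ - t) - z (2 * τ - t)) +
        (A (z (2 * τ - t)) + z (2 * τ - t)) + (z (2 * T - t) - z (2 * τ - t))) (z t)
    have h8 := norm_add₃_le (a := A (Y (2 * τ - t) - z (2 * τ - t)))
      (b := A (z (2 * τ - t)) + z (2 * τ - t)) (c := z (2 * T - t) - z (2 * τ - t))
    linarith

/-- Short trajectories starting from the reflection of data close to radial data. -/
theorem exists_nearby_reflected {G : ℝ → ℝ} (hG : ContDiffOn ℝ 1 G (Ioi 0)) {q p m : Plane}
    (hq : q ≠ 0) (hm : ‖m‖ = 1) (hqm : angMom q m = 0) (hpm : angMom p m = 0) {β : ℝ}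
    (hβ : 0 < β) :
    ∃ η > 0, ∃ μ > 0, ∀ᶠ x : ℝ × Plane × Plane in 𝓝 (0, q, p), ∀ n : Plane, ‖n‖ = 1 →
      ‖n - m‖ < μ → ∃ u v : ℝ → Plane, u 0 = reflectAlong n x.2.1 ∧
        v 0 = -reflectAlong n x.2.2 ∧ Orbit G x.1 (Icc 0 η) u v ∧
        ∀ t ∈ Icc 0 η, dist (u t) (-q) < β := by
  -- The reference trajectory lives on the single instant `0`; `Orbit.exists_nearby` then supplies a
  -- time `η` common to all nearby data. Its state is the value at `n = m`, `ε = 0` of the reflected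
  -- data.
  have hbase : Orbit G 0 (Icc 0 0) (fun _ => -q) (fun _ => p) := by
    refine ⟨fun t _ => ?_, fun t ht => ?_, fun t ht => ?_⟩
    · have := norm_pos_iff.2 hq
      simpa using by positivity
    · simp only [Icc_self, mem_singleton_iff] at ht ⊢
      rw [ht]
      exact hasDerivWithinAt_iff_hasFDerivWithinAt.2 .singleton
    · simp only [Icc_self, mem_singleton_iff] at ht ⊢
      rw [ht]
      exact hasDerivWithinAt_iff_hasFDerivWithinAt.2 .singleton
  obtain ⟨η, hη, hev⟩ := hbase.exists_nearby hG le_rfl hβ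
  let F : Plane × ℝ × Plane × Plane → ℝ × Plane × Plane := fun y =>
    (y.2.1, y.2.2.1 - (2 * inner ℝ y.1 y.2.2.1 : ℝ) • y.1,
      -(y.2.2.2 - (2 * inner ℝ y.1 y.2.2.2 : ℝ) • y.1))
  have hF : Continuous F := by fun_prop
  have hF0 : F (m, 0, q, p) = (0, -q, p) := by
    simp only [F]
    rw [← reflectAlong_apply hm, ← reflectAlong_apply hm, reflectAlong_of_angMom_eq_zero hm hqm,
      reflectAlong_of_angMom_eq_zero hm hpm, neg_neg]
  have h1 : ∀ᶠ y in 𝓝 (m, ((0 : ℝ), q, p)), F y ∈ {x : ℝ × Plane × Plane | ∃ u v : ℝ → Plane,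
      u 0 = x.2.1 ∧ v 0 = x.2.2 ∧ Orbit G x.1 (Icc 0 (0 + η)) u v ∧
      ∀ t ∈ Icc 0 (0 + η), dist (u t) (-q) < β ∧ dist (v t) p < β} := by
    refine hF.continuousAt.eventually ?_
    rw [hF0]
    exact hev
  rw [nhds_prod_eq, eventually_prod_iff] at h1
  obtain ⟨P, hP, Q, hQ, hPQ⟩ := h1
  obtain ⟨μ, hμ, hμP⟩ := Metric.eventually_nhds_iff.1 hP
  refine ⟨η, hη, μ, hμ, hQ.mono fun x hx n hn hnm => ?_⟩
  obtain ⟨u, v, hu, hv, horb, hd⟩ := hPQ (hμP (show dist n m < μ by rwa [dist_eq_norm])) hx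
  rw [zero_add] at horb hd
  exact ⟨u, v, by rw [hu, reflectAlong_apply hn], by rw [hv, reflectAlong_apply hn], horb,
    fun t ht => (hd t ht).1⟩

end Collision

/-! ### Passage near a collision, uniformly in the data and in `ε`. -/

section Collision

variable {V : ℝ → ℝ} {u v : ℝ → Plane} {T : ℝ}

theorem continuousAt_energy (hV : ContDiffOn ℝ ∞ V (Ioi 0)) {x : ℝ × Plane × Plane}
    (hx : x ∈ phaseDomain) :
    ContinuousAt (fun x : ℝ × Plane × Plane => energy V x.1 x.2.1 x.2.2) x := by
  have h1 : ContinuousAt V (√(‖x.2.1‖ ^ 2 + x.1 ^ 2)) :=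
    (hasDerivAt_of_contDiffOn hV (Real.sqrt_pos.2 hx)).continuousAt
  have h2 : ContinuousAt (fun x : ℝ × Plane × Plane => √(‖x.2.1‖ ^ 2 + x.1 ^ 2)) x := by fun_prop
  have h3 : ContinuousAt (fun x : ℝ × Plane × Plane => ‖x.2.2‖ ^ 2 / 2) x := by fun_prop
  exact h3.sub (ContinuousAt.comp (f := fun x : ℝ × Plane × Plane => √(‖x.2.1‖ ^ 2 + x.1 ^ 2))
    h1 h2)

theorem normalize_eq_neg_of_inward {x y : Plane} (hℓ : angMom x y = 0) (hin : inner ℝ x y < 0) :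
    ‖y‖⁻¹ • y = -(‖x‖⁻¹ • x) := by
  have hx : x ≠ 0 := fun h0 => by simp [h0] at hin
  have hy : y ≠ 0 := fun h0 => by simp [h0] at hin
  set e := ‖x‖⁻¹ • x with he
  have hx' : 0 < ‖x‖ := norm_pos_iff.2 hx
  have he1 : ‖e‖ = 1 := by rw [he, norm_smul, norm_inv, norm_norm, inv_mul_cancel₀ hx'.ne']
  have hpar : angMom y e = 0 := by
    refine angMom_comm_zero ?_
    rw [he, angMom_smul_left, hℓ, mul_zero]
  have hye := eq_inner_smul_of_angMom_eq_zero he1 hpar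
  have hneg : inner ℝ e y < 0 := by
    rw [he, inner_smul_left]
    exact mul_neg_of_pos_of_neg (by simpa using hx) hin
  have hnorm : ‖y‖ = -inner ℝ e y := by
    conv_lhs => rw [hye]
    rw [norm_smul, he1, mul_one, Real.norm_eq_abs, abs_of_neg hneg]
  rw [inv_smul_eq_iff₀ (norm_ne_zero_iff.2 hy), hnorm, smul_neg, neg_smul, neg_neg]
  exact hye

theorem eventually_nearCentre_inward (hV : ContDiffOn ℝ ∞ V (Ioi 0)) {u₁ v₁ : Plane}
    {E₀ r b μ : ℝ} (hpos : 0 < ‖u₁‖ ^ 2 + (0 : ℝ) ^ 2) (hr : √(‖u₁‖ ^ 2 + 0 ^ 2) < r)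
    (hE : |energy V 0 u₁ v₁| < E₀) (hin : inner ℝ u₁ v₁ < 0) (hb : ‖u₁‖ < b) (hμ : 0 < μ) :
    ∀ᶠ y : ℝ × Plane × Plane in 𝓝 (0, u₁, v₁), NearCentre V E₀ r y.1 y.2.1 y.2.2 ∧
      inner ℝ y.2.1 y.2.2 < 0 ∧ ‖y.2.1‖ < b ∧ ‖‖y.2.2‖⁻¹ • y.2.2 - ‖v₁‖⁻¹ • v₁‖ < μ := by
  have hv₁ : ‖v₁‖ ≠ 0 := norm_ne_zero_iff.2 fun h0 => by simp [h0] at hin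
  have hdom : ((0 : ℝ), u₁, v₁) ∈ phaseDomain := hpos
  have c1 : ∀ᶠ y in 𝓝 ((0 : ℝ), u₁, v₁), y ∈ phaseDomain :=
    isOpen_phaseDomain.mem_nhds hdom
  have c2 : ∀ᶠ y : ℝ × Plane × Plane in 𝓝 (0, u₁, v₁), √(‖y.2.1‖ ^ 2 + y.1 ^ 2) < r := by
    have hc : Continuous fun y : ℝ × Plane × Plane => √(‖y.2.1‖ ^ 2 + y.1 ^ 2) := by fun_prop
    exact hc.continuousAt.eventually_lt continuousAt_const hr
  have c3 : ∀ᶠ y : ℝ × Plane × Plane in 𝓝 (0, u₁, v₁), |energy V y.1 y.2.1 y.2.2| < E₀ := by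
    have hc := (continuousAt_energy hV hdom).abs
    exact hc.eventually_lt continuousAt_const hE
  have c4 : ∀ᶠ y : ℝ × Plane × Plane in 𝓝 (0, u₁, v₁), inner ℝ y.2.1 y.2.2 < 0 := by
    have hc : Continuous fun y : ℝ × Plane × Plane => (inner ℝ y.2.1 y.2.2 : ℝ) := by fun_prop
    exact hc.continuousAt.eventually_lt continuousAt_const hin
  have c5 : ∀ᶠ y : ℝ × Plane × Plane in 𝓝 (0, u₁, v₁), ‖y.2.1‖ < b := by
    have hc : Continuous fun y : ℝ × Plane × Plane => ‖y.2.1‖ := by fun_prop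
    exact hc.continuousAt.eventually_lt continuousAt_const hb
  have c6 : ∀ᶠ y : ℝ × Plane × Plane in 𝓝 (0, u₁, v₁),
      ‖‖y.2.2‖⁻¹ • y.2.2 - ‖v₁‖⁻¹ • v₁‖ < μ := by
    have hw : ContinuousAt (fun w : Plane => ‖‖w‖⁻¹ • w - ‖v₁‖⁻¹ • v₁‖) v₁ :=
      (((continuous_norm.continuousAt.inv₀ hv₁).smul continuousAt_id).sub
        continuousAt_const).norm
    have hw' : ∀ᶠ w in 𝓝 v₁, ‖‖w‖⁻¹ • w - ‖v₁‖⁻¹ • v₁‖ < μ :=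
      hw.eventually_lt continuousAt_const (by simpa using hμ)
    have hc : Tendsto (fun y : ℝ × Plane × Plane => y.2.2) (𝓝 (0, u₁, v₁)) (𝓝 v₁) :=
      (continuous_snd.comp continuous_snd).continuousAt
    exact hc.eventually hw'
  filter_upwards [c1, c2, c3, c4, c5, c6] with y d1 d2 d3 d4 d5 d6
  exact ⟨⟨d1, d2.le, d3.le⟩, d4, d5, d6⟩

/-- Trajectories with data close to those of a collision trajectory follow it up to a time shortly
before the collision, where they are in a small neighbourhood of the centre and move inwards. -/
theorem ClassVStar.exists_approach (hV : ClassVStar V) (hT : 0 < T)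
    (h : Orbit (centralCoeff V) 0 (Ico 0 T) u v) (hlim : Tendsto u (𝓝[<] T) (𝓝 0))
    {β θ μ : ℝ} (hβ : 0 < β) (hθ : 0 < θ) (hμ : 0 < μ) :
    ∃ κ E₀ r t₁ : ℝ, 0 ≤ κ ∧ κ ≤ 1 / 2 ∧ 8 * κ ≤ μ / 2 ∧ 0 ≤ E₀ ∧
      SlowNearZero V κ (2 * E₀ + 2) r ∧ T - θ < t₁ ∧ t₁ ∈ Ico 0 T ∧
      ∀ᶠ x : ℝ × Plane × Plane in 𝓝 (0, u 0, v 0), ∃ u' v' : ℝ → Plane,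
        u' 0 = x.2.1 ∧ v' 0 = x.2.2 ∧ Orbit (centralCoeff V) x.1 (Icc 0 t₁) u' v' ∧
        (∀ t ∈ Icc 0 t₁, dist (u' t) (u t) < β) ∧ NearCentre V E₀ r x.1 (u' t₁) (v' t₁) ∧
        inner ℝ (u' t₁) (v' t₁) < 0 ∧ 2 * ‖u' t₁‖ < θ ∧ ‖u' t₁‖ < 2 * β ∧
        ‖‖v' t₁‖⁻¹ • v' t₁ - -(‖u 0‖⁻¹ • u 0)‖ < μ / 2 := by
  -- The summand `1` leaves room for the energies of nearby data. The choice of `κ` gives `8 κ ≤ μ /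
  -- 2`; the other half of `μ` is for the direction of the velocity at `t₁`.
  set E₀ := |energy V 0 (u 0) (v 0)| + 1 with hE₀
  set κ := min (1 / 2) (μ / 16) with hκ
  have hκ0 : 0 < κ := by positivity
  have hE₀0 : 0 ≤ E₀ := by positivity
  obtain ⟨r, hS⟩ := hV.exists_slowNearZero hκ0 (2 * E₀ + 2)
  have hκ1 : κ ≤ 1 / 2 := min_le_left _ _
  have hκ2 : κ ≤ μ / 16 := min_le_right _ _
  have hEn : |energy V 0 (u 0) (v 0)| ≤ E₀ := by linarith
  have hℓ := hV.angMom_eq_zero_of_collision hT h hlim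
  have hev1 := h.eventually_nearCentre hV.smooth hT hlim hEn hS.radius_pos
  have hev2 := h.eventually_inner_neg hV.smooth hT hlim hκ0.le hκ1 hEn hS
  -- The bound `θ / 2` makes the rest of the inward motion shorter than `θ`, as it lasts at most
  -- twice the distance to the centre.
  have hev3 : ∀ᶠ t in 𝓝[<] T, ‖u t‖ < min r (min (θ / 2) (2 * β)) :=
    (tendsto_zero_iff_norm_tendsto_zero.1 hlim).eventually
      (gt_mem_nhds (lt_min hS.radius_pos (by positivity)))
  have hev4 : ∀ᶠ t in 𝓝[<] T, T - θ < t :=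
    eventually_nhdsWithin_of_eventually_nhds (lt_mem_nhds (by linarith))
  obtain ⟨t₁, h1, h2, h3, h4, ht₁⟩ :=
    (hev1.and (hev2.and (hev3.and (hev4.and (Ico_mem_nhdsLT hT))))).exists
  refine ⟨κ, E₀, r, t₁, hκ0.le, hκ1, by linarith, hE₀0, hS, h4, ht₁, ?_⟩
  rw [lt_min_iff, lt_min_iff] at h3
  have hI := h.mono (show Icc 0 t₁ ⊆ Ico 0 T from fun s hs => ⟨hs.1, hs.2.trans_lt ht₁.2⟩)
  have hdir : ‖v t₁‖⁻¹ • v t₁ = -(‖u 0‖⁻¹ • u 0) := by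
    rw [← (h.direction_eq_of_angMom_eq_zero hℓ t₁ ht₁).1]
    exact normalize_eq_neg_of_inward ((hI.angMom_eq t₁ (right_mem_Icc.2 ht₁.1)).trans hℓ) h2
  have hen : |energy V 0 (u t₁) (v t₁)| < E₀ := by
    rw [hI.energy_eq hV.smooth t₁ (right_mem_Icc.2 ht₁.1)]
    linarith
  have hopen := eventually_nearCentre_inward hV.smooth h1.pos (by simpa using h3.1) hen h2
    (lt_min h3.2.1 h3.2.2) (half_pos hμ)
  rw [hdir] at hopen
  obtain ⟨ρ, hρ, hball⟩ := Metric.eventually_nhds_iff.1 hopen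
  obtain ⟨η, hη, hnear⟩ := hI.exists_nearby (contDiffOn_centralCoeff hV.smooth) ht₁.1
    (lt_min hρ hβ)
  have hε : ∀ᶠ x : ℝ × Plane × Plane in 𝓝 (0, u 0, v 0), dist x.1 0 < ρ :=
    continuous_fst.continuousAt.eventually (Metric.ball_mem_nhds _ hρ)
  filter_upwards [hnear, hε] with x hx hxε
  obtain ⟨u', v', hu', hv', horb, hd⟩ := hx
  have hsub : Icc 0 t₁ ⊆ Icc 0 (t₁ + η) := Icc_subset_Icc_right (by linarith)
  have hd₁ := hd t₁ (hsub (right_mem_Icc.2 ht₁.1))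
  rw [min_self] at hd₁
  obtain ⟨e1, e2, e3, e4⟩ := hball (y := (x.1, u' t₁, v' t₁)) <| by
    exact max_lt hxε (max_lt (hd₁.1.trans_le (min_le_left _ _)) (hd₁.2.trans_le (min_le_left _ _)))
  rw [lt_min_iff] at e3
  refine ⟨u', v', hu', hv', horb.mono hsub, fun t ht => ?_, e1, e2, by linarith [e3.1], e3.2, e4⟩
  have := (hd t (hsub ht)).1
  rw [min_eq_left ht.2] at this
  exact this.trans_le (min_le_right _ _)

/-- Trajectories with data close to those of a collision trajectory follow it up to a time close to
the collision time, at which they reach either a pericentre or the centre. -/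
theorem ClassVStar.exists_half_passage (hV : ClassVStar V) (hT : 0 < T)
    (h : Orbit (centralCoeff V) 0 (Ico 0 T) u v) (hlim : Tendsto u (𝓝[<] T) (𝓝 0))
    {β θ μ : ℝ} (hθ : 0 < θ) (hμ : 0 < μ)
    (hz : ∀ a b, |a - b| ≤ 2 * θ → dist (stoppedPath T u a) (stoppedPath T u b) < β) :
    ∀ᶠ x : ℝ × Plane × Plane in 𝓝 (0, u 0, v 0),
      ((x.1 ≠ 0 ∨ angMom x.2.1 x.2.2 ≠ 0) → ∃ (τ : ℝ) (u' v' : ℝ → Plane), 0 < τ ∧ |τ - T| ≤ θ ∧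
        u' 0 = x.2.1 ∧ v' 0 = x.2.2 ∧ Orbit (centralCoeff V) x.1 (Icc 0 τ) u' v' ∧
        inner ℝ (u' τ) (v' τ) = 0 ∧ v' τ ≠ 0 ∧
        ‖‖v' τ‖⁻¹ • v' τ - -(‖u 0‖⁻¹ • u 0)‖ < μ ∧
        ∀ t ∈ Icc 0 τ, dist (u' t) (stoppedPath T u t) < 3 * β) ∧
      (x.1 = 0 → angMom x.2.1 x.2.2 = 0 → ∃ (τ : ℝ) (u' v' : ℝ → Plane), 0 < τ ∧ |τ - T| ≤ θ ∧
        u' 0 = x.2.1 ∧ v' 0 = x.2.2 ∧ Orbit (centralCoeff V) 0 (Ico 0 τ) u' v' ∧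
        Tendsto u' (𝓝[<] τ) (𝓝 0) ∧
        ∀ t ∈ Ico 0 τ, dist (u' t) (stoppedPath T u t) < 3 * β) := by
  have hβ : 0 < β := by
    have := hz 0 0 (by rw [sub_self, abs_zero]; positivity)
    rwa [dist_self] at this
  obtain ⟨κ, E₀, r, t₁, hκ, hκ', hκμ, hE₀, hS, ht₁θ, ht₁, hev⟩ :=
    hV.exists_approach hT h hlim hβ hθ hμ
  have hsmall : ∀ t, t₁ ≤ t → ‖stoppedPath T u t‖ < β := fun t ht => by
    have h1 := hz t (max t T) (by
      rw [abs_sub_comm, abs_of_nonneg (by linarith [le_max_left t T])]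
      rcases max_cases t T with h | h <;> linarith)
    rwa [stoppedPath_of_ge (le_max_right _ _), dist_zero_right] at h1
  filter_upwards [hev] with x hx
  obtain ⟨u₁, v₁, hu₁, hv₁, horb₁, hclose, hnear, hin, hshort, hsmall₁, hdir⟩ := hx
  have hfirst : ∀ t ∈ Icc 0 t₁, dist (u₁ t) (stoppedPath T u t) < 3 * β := fun t ht => by
    rw [stoppedPath_of_mem ⟨ht.1, ht.2.trans_lt ht₁.2⟩]
    linarith [hclose t ht]
  have hdist : ∀ (y : Plane) t, ‖y‖ ≤ ‖u₁ t₁‖ → t₁ ≤ t → dist y (stoppedPath T u t) < 3 * β :=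
    fun y t hy ht => by
      have h1 := hsmall t ht
      have h2 := norm_sub_le y (stoppedPath T u t)
      rw [dist_eq_norm]
      linarith
  have hpos : 0 < ‖u₁ t₁‖ := by
    rw [norm_pos_iff]
    intro h0
    simp [h0] at hin
  have hℓ₁ := horb₁.angMom_eq t₁ (right_mem_Icc.2 ht₁.1)
  rw [hu₁, hv₁] at hℓ₁
  constructor
  · intro hne
    obtain ⟨s, u₂, v₂, hs, hs₁, hu₂, hv₂, horb₂, hz₂, hv₂s, hle₂, hdir₂⟩ :=
      exists_pericentre hV.smooth hκ hκ' hE₀ hS (ε := x.1) (ν := (u₁ t₁, v₁ t₁)) hnear hin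
        (by rwa [hℓ₁])
    have hglue := horb₁.glue (horb₂.shift t₁ (J := Icc t₁ (t₁ + s))
      fun t ht => ⟨by linarith [ht.1], by linarith [ht.2]⟩) (fun t ht => ht.2) (fun t ht => ht.1)
      (right_mem_Icc.2 ht₁.1) ⟨le_rfl, by linarith⟩ (by simp [hu₂]) (by simp [hv₂])
    rw [Icc_union_Icc_eq_Icc ht₁.1 (by linarith)] at hglue
    have hend : ¬ t₁ + s < t₁ := by linarith
    refine ⟨t₁ + s, _, _, by linarith [ht₁.1], ?_, ?_, ?_, hglue, ?_, ?_, ?_, ?_⟩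
    · rw [abs_le]
      exact ⟨by linarith, by linarith [ht₁.2]⟩
    · rcases ht₁.1.eq_or_lt with h0 | h0
      · simp [← h0, hu₂, hu₁]
      · simp [h0, hu₁]
    · rcases ht₁.1.eq_or_lt with h0 | h0
      · simp [← h0, hv₂, hv₁]
      · simp [h0, hv₁]
    · simpa [hend] using hz₂
    · simpa [hend] using hv₂s
    · simp only [hend, if_false, add_sub_cancel_left]
      have := norm_sub_le_norm_sub_add_norm_sub (‖v₂ s‖⁻¹ • v₂ s) (‖v₁ t₁‖⁻¹ • v₁ t₁)
        (-(‖u 0‖⁻¹ • u 0))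
      linarith
    · intro t ht
      split_ifs with htt
      · exact hfirst t ⟨ht.1, htt.le⟩
      · rw [not_lt] at htt
        exact hdist _ t (hle₂ _ ⟨by linarith, by linarith [ht.2]⟩) htt
  · intro hε hℓ
    rw [hε] at horb₁ hnear
    obtain ⟨s, u₂, v₂, hs, hs₁, hu₂, hv₂, horb₂, hle₂, hlim₂⟩ :=
      exists_collision hV.smooth hκ hκ' hE₀ hS (ν := (u₁ t₁, v₁ t₁)) hnear hin (by rwa [hℓ₁])
    have hglue := horb₁.glue (horb₂.shift t₁ (J := Ico t₁ (t₁ + s))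
      fun t ht => ⟨by linarith [ht.1], by linarith [ht.2]⟩) (fun t ht => ht.2) (fun t ht => ht.1)
      (right_mem_Icc.2 ht₁.1) ⟨le_rfl, by linarith⟩ (by simp [hu₂]) (by simp [hv₂])
    rw [Icc_union_Ico_eq_Ico ht₁.1 (by linarith)] at hglue
    refine ⟨t₁ + s, _, _, by linarith [ht₁.1], ?_, ?_, ?_, hglue, ?_, ?_⟩
    · rw [abs_le]
      exact ⟨by linarith, by linarith [ht₁.2]⟩
    · rcases ht₁.1.eq_or_lt with h0 | h0
      · simp [← h0, hu₂, hu₁]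
      · simp [h0, hu₁]
    · rcases ht₁.1.eq_or_lt with h0 | h0
      · simp [← h0, hv₂, hv₁]
      · simp [h0, hv₁]
    · have hshift : Tendsto (fun t => t - t₁) (𝓝[<] (t₁ + s)) (𝓝[<] s) := by
        refine tendsto_nhdsWithin_iff.2 ⟨?_, ?_⟩
        · have : Tendsto (fun t => t - t₁) (𝓝 (t₁ + s)) (𝓝 (t₁ + s - t₁)) :=
            (continuous_id.sub continuous_const).tendsto _
          rw [add_sub_cancel_left] at this
          exact this.mono_left nhdsWithin_le_nhds
        · filter_upwards [self_mem_nhdsWithin] with t ht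
          rw [mem_Iio] at ht ⊢
          linarith
      refine (hlim₂.comp hshift).congr' ?_
      filter_upwards [Ico_mem_nhdsLT (show t₁ < t₁ + s by linarith)] with t ht
      simp [not_lt.2 ht.1]
    · intro t ht
      split_ifs with htt
      · exact hfirst t ⟨ht.1, htt.le⟩
      · rw [not_lt] at htt
        exact hdist _ t (hle₂ _ ⟨by linarith, by linarith [ht.2]⟩) htt

/-- Trajectories with data close to those of a collision trajectory either avoid the singularity
beyond twice the collision time or collide at a nearby time; in both cases they remain close to the
transmission solution. -/
theorem ClassVStar.eventually_near_transmission (hV : ClassVStar V) (hT : 0 < T)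
    (h : Orbit (centralCoeff V) 0 (Ico 0 T) u v) (hlim : Tendsto u (𝓝[<] T) (𝓝 0))
    {δ : ℝ} (hδ : 0 < δ) :
    ∃ η > 0, ∀ᶠ x : ℝ × Plane × Plane in 𝓝 (0, u 0, v 0),
      ((x.1 ≠ 0 ∨ angMom x.2.1 x.2.2 ≠ 0) → ∃ u' v' : ℝ → Plane, u' 0 = x.2.1 ∧ v' 0 = x.2.2 ∧
        Orbit (centralCoeff V) x.1 (Icc 0 (2 * T + η)) u' v' ∧
        ∀ t ∈ Icc 0 (2 * T + η),
          dist (u' t) (stoppedPath T u t - stoppedPath T u (2 * T - t)) < δ) ∧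
      (x.1 = 0 → angMom x.2.1 x.2.2 = 0 → ∃ (τ : ℝ) (u' v' : ℝ → Plane), 0 < τ ∧ |τ - T| < δ ∧
        u' 0 = x.2.1 ∧ v' 0 = x.2.2 ∧ Orbit (centralCoeff V) 0 (Ico 0 τ) u' v' ∧
        Tendsto u' (𝓝[<] τ) (𝓝 0) ∧
        ∀ t ∈ Icc 0 (2 * τ),
          dist (transmission τ u' t) (stoppedPath T u t - stoppedPath T u (2 * T - t)) < δ) := by
  have hG := contDiffOn_centralCoeff hV.smooth
  have hℓ := hV.angMom_eq_zero_of_collision hT h hlim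
  set z := stoppedPath T u with hz
  have hzu : UniformContinuous z := uniformContinuous_stoppedPath hT h.continuousOn_fst hlim
  have hu0 : u 0 ≠ 0 := fun hu => by
    have := h.pos 0 ⟨le_rfl, hT⟩
    simp [hu] at this
  set m : Plane := -(‖u 0‖⁻¹ • u 0) with hm
  have hm' : m = (-‖u 0‖⁻¹) • u 0 := by rw [hm, neg_smul]
  have hm1 : ‖m‖ = 1 := by
    rw [hm, norm_neg, norm_smul, norm_inv, norm_norm, inv_mul_cancel₀ (norm_ne_zero_iff.2 hu0)]
  have hpar : ∀ y : Plane, angMom y (u 0) = 0 → angMom y m = 0 := fun y hy => by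
    refine angMom_comm_zero ?_
    rw [hm', angMom_smul_left, angMom_comm_zero hy, mul_zero]
  have hzm : ∀ t, angMom (z t) m = 0 := fun t => by
    refine hpar _ ?_
    simp only [hz, stoppedPath]
    split_ifs with htT
    · exact (h.direction_eq_of_angMom_eq_zero hℓ _ ⟨le_max_right _ _, max_lt htT hT⟩).2
    · simp [angMom]
  obtain ⟨M, hM0, hM⟩ : ∃ M, 0 < M ∧ ∀ t, ‖z t‖ ≤ M := by
    obtain ⟨M, hM⟩ := isCompact_Icc.exists_bound_of_continuousOn (s := Icc 0 T)
      hzu.continuous.continuousOn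
    refine ⟨max M 1, by positivity, fun t => ?_⟩
    rcases lt_or_ge t 0 with ht | ht
    · rw [hz, stoppedPath_of_le hT ht.le, ← stoppedPath_of_le (T := T) (u := u) hT le_rfl]
      exact (hM 0 ⟨le_rfl, hT.le⟩).trans (le_max_left _ _)
    · rcases lt_or_ge t T with ht' | ht'
      · exact (hM t ⟨ht, ht'.le⟩).trans (le_max_left _ _)
      · rw [hz, stoppedPath_of_ge ht', norm_zero]
        positivity
  set β := δ / 6 with hβ
  have hβ0 : 0 < β := by positivity
  obtain ⟨η, hη, μ₀, hμ₀, htail⟩ := exists_nearby_reflected hG hu0 hm1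
    (hpar _ (angMom_self _)) (hpar _ (angMom_comm_zero hℓ)) hβ0
  -- The second bound makes the reflection differ from `-1` by less than `β` along the path, whose
  -- norm is at most `M`.
  set μ := min μ₀ (β / (4 * M)) with hμ
  have hμ0 : 0 < μ := by positivity
  obtain ⟨θ₀, hθ₀, hθ₀z⟩ := Metric.uniformContinuous_iff.1 hzu β hβ0
  -- As `|τ - T| ≤ θ ≤ η / 4`, an extension by `η` after `2 τ` still reaches `2 T + η / 2`.
  set θ := min (θ₀ / 4) (min (η / 4) (δ / 2)) with hθ
  have hθ0 : 0 < θ := by positivity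
  have hθ1 : θ ≤ θ₀ / 4 := min_le_left _ _
  have hθ2 : θ ≤ η / 4 := (min_le_right _ _).trans (min_le_left _ _)
  have hθ3 : θ ≤ δ / 2 := (min_le_right _ _).trans (min_le_right _ _)
  have hzθ : ∀ a b, |a - b| ≤ 2 * θ → dist (z a) (z b) < β := fun a b hab =>
    hθ₀z (show dist a b < θ₀ by rw [Real.dist_eq]; linarith)
  refine ⟨η / 2, by positivity, ?_⟩
  filter_upwards [hV.exists_half_passage hT h hlim hθ0 hμ0 hzθ, htail] with x hx hxtail
  refine ⟨fun hne => ?_, fun hε hℓx => ?_⟩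
  · obtain ⟨τ, u₁, v₁, hτ, hτT, hu₁, hv₁, horb₁, hin₁, hv₁τ, hdir₁, hclose₁⟩ := hx.1 hne
    set n := ‖v₁ τ‖⁻¹ • v₁ τ with hn
    have hn1 : ‖n‖ = 1 := by
      rw [hn, norm_smul, norm_inv, norm_norm, inv_mul_cancel₀ (norm_ne_zero_iff.2 hv₁τ)]
    obtain ⟨u₂, v₂, horb₂, hu₂, hv₂, hrefl, hv₂τ⟩ :=
      horb₁.reflect_at_pericentre hτ hin₁ hv₁τ hn
    obtain ⟨u₃, v₃, hu₃, hv₃, horb₃, hclose₃⟩ :=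
      hxtail n hn1 (hdir₁.trans_le (min_le_left _ _))
    have hu₂0 : u₂ 0 = x.2.1 := (hu₂ 0 ⟨le_rfl, hτ.le⟩).trans hu₁
    have hu₂τ : u₂ (2 * τ) = reflectAlong n x.2.1 := by
      rw [hrefl (2 * τ) ⟨by linarith, le_rfl⟩, sub_self, hu₂0]
    have hmid := dist_transmission_lt (T := T) (z := z) (Y := u₂) (β := β) (θ := θ) (τ := τ)
      (reflectAlong n) hzθ (fun t ht => stoppedPath_of_ge ht) hτT
      (fun t => by
        refine (norm_reflectAlong_add_le hn1 hm1 (hzm t)).trans_lt ?_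
        have h1 : ‖n - m‖ < β / (4 * M) := hdir₁.trans_le (min_le_right _ _)
        rw [lt_div_iff₀ (by positivity)] at h1
        have h2 := mul_le_mul_of_nonneg_right (hM t) (norm_nonneg (n - m))
        linarith)
      (fun t ht => by rw [hu₂ t ht]; exact hclose₁ t ht) hrefl
    have hglue := horb₂.glue (horb₃.shift (2 * τ) (J := Icc (2 * τ) (2 * τ + η))
      fun t ht => ⟨by linarith [ht.1], by linarith [ht.2]⟩) (fun t ht => ht.2) (fun t ht => ht.1)
      (right_mem_Icc.2 (by linarith)) ⟨le_rfl, by linarith⟩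
      (by simp only [sub_self]; rw [hu₂τ, hu₃]) (by simp only [sub_self]; rw [hv₂τ, hv₃, hv₁])
    rw [Icc_union_Icc_eq_Icc (by linarith) (by linarith)] at hglue
    have hτT' := abs_le.1 hτT
    refine ⟨_, _, ?_, ?_, hglue.mono (Icc_subset_Icc_right (by linarith)), fun t ht => ?_⟩
    · simp [hτ, hu₂0]
    · simp [hτ, hv₂, hv₁]
    · split_ifs with htτ
      · have := hmid t ⟨ht.1, htτ.le⟩
        rwa [show 6 * β = δ by rw [hβ]; ring] at this
      · rw [not_lt] at htτ
        -- Past `2 τ` the trajectory is near `-u 0`, `z (2 T - t)` is near `u 0`, and `z t` is near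
        -- zero.
        have h1 := hclose₃ (t - 2 * τ) ⟨by linarith, by linarith [ht.2]⟩
        have h2 := hzθ t (max t T) (by
          rw [abs_sub_comm, abs_of_nonneg (by linarith [le_max_left t T])]
          rcases max_cases t T with h | h <;> linarith)
        have h3 := hzθ (2 * T - t) (min (2 * T - t) 0) (by
          rw [abs_of_nonneg (by linarith [min_le_left (2 * T - t) 0])]
          rcases min_cases (2 * T - t) 0 with h | h <;> linarith)
        rw [hz, stoppedPath_of_ge (le_max_right _ _), ← hz, dist_zero_right] at h2
        rw [hz, stoppedPath_of_le hT (min_le_right _ _), ← hz] at h3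
        rw [dist_eq_norm] at h1 h3 ⊢
        have h4 : u₃ (t - 2 * τ) - (z t - z (2 * T - t)) =
            (u₃ (t - 2 * τ) - -u 0) + (z (2 * T - t) - u 0) - z t := by abel
        have h5 := norm_sub_le ((u₃ (t - 2 * τ) - -u 0) + (z (2 * T - t) - u 0)) (z t)
        have h6 := norm_add_le (u₃ (t - 2 * τ) - -u 0) (z (2 * T - t) - u 0)
        rw [h4]
        linarith
  · obtain ⟨τ, u₁, v₁, hτ, hτT, hu₁, hv₁, horb₁, hlim₁, hclose₁⟩ := hx.2 hε hℓx
    refine ⟨τ, u₁, v₁, hτ, by linarith, hu₁, hv₁, horb₁, hlim₁, ?_⟩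
    have hτT' := abs_le.1 hτT
    -- In the colliding case the symmetry is exactly `-1`.
    have hmid := dist_transmission_lt (T := T) (z := z) (Y := transmission τ u₁) (β := β)
      (θ := θ) (τ := τ) (LinearIsometryEquiv.neg ℝ).toLinearIsometry hzθ
      (fun t ht => stoppedPath_of_ge ht) hτT (fun t => by simpa using hβ0)
      (fun t ht => by
        rcases ht.2.lt_or_eq with htτ | htτ
        · simp only [transmission, htτ, if_true]
          exact hclose₁ t ⟨ht.1, htτ⟩
        · have h2 := hzθ t (max t T) (by
            rw [abs_sub_comm, abs_of_nonneg (by linarith [le_max_left t T])]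
            rcases max_cases t T with h | h <;> linarith)
          rw [hz, stoppedPath_of_ge (le_max_right _ _), ← hz, dist_zero_right] at h2
          simp only [transmission, htτ, lt_irrefl, if_false, if_true, dist_zero_left]
          rw [← htτ]
          linarith)
      (fun t ht => by
        rcases ht.1.lt_or_eq with htτ | htτ
        · simp [transmission, htτ.not_gt, htτ.ne', show 2 * τ - t < τ by linarith]
        · simp [transmission, ← htτ, show 2 * τ - τ = τ by ring])
    rwa [show 6 * β = δ by rw [hβ]; ring] at hmid

end Collision

/-! ### Admissible radii, the extended flow, and the theorem. -/

section Main

variable {V : ℝ → ℝ} {R : EReal}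

/-- The limit `g₀` of `V' / V''` at `0` is at most `0` and the slope there is below `-1/2`, so `V' /
V'' ≤ -x / 2` near `0`. -/
theorem ClassVStar.exists_admissibleRadius (hV : ClassVStar V) :
    ∃ R : EReal, IsAdmissibleRadius V R := by
  obtain ⟨S, hS, hconv⟩ := hV.convex_near_zero
  obtain ⟨g₀, d, hg₀, hd, hd'⟩ := hV.slope_at_zero
  obtain ⟨s, hs0, hsS⟩ : ∃ s : ℝ, 0 < s ∧ (s : EReal) < S := by
    obtain ⟨s, h1, h2⟩ := EReal.lt_iff_exists_real_btwn.1 hS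
    exact ⟨s, by exact_mod_cast h1, h2⟩
  have hg₀' : g₀ ≤ 0 := by
    refine le_of_tendsto hg₀ ?_
    filter_upwards [Ioo_mem_nhdsGT hs0] with x hx
    have hx' : x ∈ openInterval S := ⟨hx.1, lt_trans (by exact_mod_cast hx.2) hsS⟩
    exact (div_neg_of_neg_of_pos (hconv.deriv_neg x hx') (hconv.deriv2_pos x hx')).le
  rw [hasDerivWithinAt_iff_tendsto_slope' self_notMem_Ioi] at hd
  have hev : ∀ᶠ x in 𝓝[>] (0 : ℝ), derivRatio V x ≤ -x / 2 := by
    filter_upwards [hd.eventually (gt_mem_nhds hd'), self_mem_nhdsWithin] with x hx hx0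
    rw [mem_Ioi] at hx0
    rw [slope_def_field, Function.update_self, Function.update_of_ne hx0.ne', sub_zero,
      div_lt_iff₀ hx0] at hx
    linarith
  obtain ⟨τ, hτ0, hτ⟩ := mem_nhdsGT_iff_exists_Ioo_subset.1 hev
  refine ⟨_, S, (τ : EReal), hS, by exact_mod_cast hτ0, hconv, fun x hx => hτ ⟨hx.1, ?_⟩, rfl⟩
  exact_mod_cast hx.2

namespace CollidesAt

variable {ν : Plane × Plane} {T : ℝ} {u : ℝ → Plane}

theorem exists_orbit (hV : ContDiffOn ℝ ∞ V (Ioi 0)) (h : CollidesAt V ν T u) :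
    ∃ v : ℝ → Plane, u 0 = ν.1 ∧ v 0 = ν.2 ∧ Orbit (centralCoeff V) 0 (Ico 0 T) u v :=
  (isClassicalSolution_iff_orbit hV).1 h.2.1

/-- A collision-free orbit existing at time `T` would, by uniqueness before `T` and continuity, be
at the centre then. This also makes the collision time unique. -/
theorem lt_and_eq_of_orbit (hV : ContDiffOn ℝ ∞ V (Ioi 0)) (h : CollidesAt V ν T u) {a : ℝ}
    {u' v' : ℝ → Plane} (hu' : u' 0 = ν.1) (hv' : v' 0 = ν.2)
    (horb' : Orbit (centralCoeff V) 0 (Icc 0 a) u' v') :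
    a < T ∧ ∀ t ∈ Icc 0 a, u' t = u t := by
  obtain ⟨v, hu, hv, horb⟩ := h.exists_orbit hV
  have hT := h.1
  have heq : ∀ b, b < T → b ≤ a → ∀ t ∈ Icc 0 b, u' t = u t := fun b hbT hba t ht =>
    ((horb'.mono (Icc_subset_Icc_right hba)).unique (contDiffOn_centralCoeff hV)
      (horb.mono fun s hs => ⟨hs.1, hs.2.trans_lt hbT⟩) (hu'.trans hu.symm) (hv'.trans hv.symm)
      t ht).1
  have haT : a < T := by
    by_contra hTa
    rw [not_lt] at hTa
    have h1 : Tendsto u' (𝓝[<] T) (𝓝 (u' T)) :=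
      (horb'.continuousOn_fst T ⟨hT.le, hTa⟩).mono_left
        (nhdsWithin_le_iff.2 (mem_of_superset (Ico_mem_nhdsLT hT)
          fun s hs => ⟨hs.1, hs.2.le.trans hTa⟩))
    have h2 : u' T = 0 := by
      refine tendsto_nhds_unique_of_eventuallyEq h1 h.2.2 ?_
      filter_upwards [Ico_mem_nhdsLT hT] with t ht
      exact heq t ht.2 (ht.2.le.trans hTa) t (right_mem_Icc.2 ht.1)
    have h3 := horb'.pos T ⟨hT.le, hTa⟩
    simp [h2] at h3
  exact ⟨haT, heq a haT le_rfl⟩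

theorem unique (hV : ContDiffOn ℝ ∞ V (Ioi 0)) (h : CollidesAt V ν T u) {T' : ℝ}
    {u' : ℝ → Plane} (h' : CollidesAt V ν T' u') : T' = T ∧ ∀ t ∈ Ico 0 T, u' t = u t := by
  obtain ⟨v, hu, hv, horb⟩ := h.exists_orbit hV
  obtain ⟨v', hu', hv', horb'⟩ := h'.exists_orbit hV
  have hTT' : T' = T := by
    rcases lt_trichotomy T' T with hlt | heq | hlt
    · exact absurd (h'.lt_and_eq_of_orbit hV hu hv
        (horb.mono fun s hs => ⟨hs.1, hs.2.trans_lt hlt⟩)).1 (lt_irrefl _)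
    · exact heq
    · exact absurd (h.lt_and_eq_of_orbit hV hu' hv'
        (horb'.mono fun s hs => ⟨hs.1, hs.2.trans_lt hlt⟩)).1 (lt_irrefl _)
  refine ⟨hTT', fun t ht => ?_⟩
  exact (h.lt_and_eq_of_orbit hV hu' hv' (a := t) (horb'.mono fun s hs =>
    ⟨hs.1, by rw [hTT']; exact hs.2.trans_lt ht.2⟩)).2 t (right_mem_Icc.2 ht.1)

theorem transmission_congr (hV : ContDiffOn ℝ ∞ V (Ioi 0)) (h : CollidesAt V ν T u) {T' : ℝ}
    {u' : ℝ → Plane} (h' : CollidesAt V ν T' u') {t : ℝ} (ht : t ∈ Icc 0 (2 * T)) :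
    transmission T' u' t = transmission T u t := by
  obtain ⟨rfl, heq⟩ := h.unique hV h'
  rcases lt_trichotomy t T' with h1 | h1 | h1
  · simp [transmission, h1, heq t ⟨ht.1, h1⟩]
  · simp [transmission, h1]
  · simp [transmission, h1.not_gt, h1.ne',
      heq (2 * T' - t) ⟨by linarith [ht.2], by linarith⟩]

end CollidesAt

open Classical in
/-- The extended flow: the transmission solution for data leading to a collision, the classical
solution for the other data. -/
noncomputable def extendedFlow (V : ℝ → ℝ) (R : EReal) (ν : Plane × Plane) (t : ℝ) : Plane :=
  if h : ν ∈ collisionData V R then transmission h.2.choose h.2.choose_spec.choose t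
  else if h' : ∃ u, IsClassicalSolution V ν (Icc 0 t) u then h'.choose t else 0

theorem isExtendedFlow_extendedFlow (hV : ContDiffOn ℝ ∞ V (Ioi 0)) :
    IsExtendedFlow V R (extendedFlow V R) where
  eq_transmission ν hν T u h t ht := by
    rw [extendedFlow, dif_pos hν]
    exact h.transmission_congr hV hν.2.choose_spec.choose_spec ht
  eq_classical ν _ hν τ u h t ht := by
    obtain ⟨v, hu, hv, horb⟩ := (isClassicalSolution_iff_orbit hV).1 h
    have horb₁ := horb.mono (Icc_subset_Icc_right ht.2)
    have hex : ∃ u, IsClassicalSolution V ν (Icc 0 t) u :=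
      ⟨u, (isClassicalSolution_iff_orbit hV).2 ⟨v, hu, hv, horb₁⟩⟩
    rw [extendedFlow, dif_neg hν, dif_pos hex]
    obtain ⟨v', hu', hv', horb'⟩ := (isClassicalSolution_iff_orbit hV).1 hex.choose_spec
    exact (horb'.unique (contDiffOn_centralCoeff hV) horb₁ (hu'.trans hu.symm)
      (hv'.trans hv.symm) t (right_mem_Icc.2 ht.1)).1

/-- Covers data that collide after time `a`, so local arguments need not know whether nearby data
eventually collide. -/
theorem IsExtendedFlow.eq_of_orbit (hV : ContDiffOn ℝ ∞ V (Ioi 0))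
    {Φ : Plane × Plane → ℝ → Plane} (hΦ : IsExtendedFlow V R Φ) {ν : Plane × Plane}
    (hν : ν ∈ ballData R) {a : ℝ} {u v : ℝ → Plane} (hu : u 0 = ν.1) (hv : v 0 = ν.2)
    (horb : Orbit (centralCoeff V) 0 (Icc 0 a) u v) {t : ℝ} (ht : t ∈ Icc 0 a) :
    (ν, t) ∈ flowDomain V R ∧ Φ ν t = u t := by
  by_cases hc : ν ∈ collisionData V R
  · obtain ⟨T, u', h⟩ := hc.2
    obtain ⟨haT, heq⟩ := h.lt_and_eq_of_orbit hV hu hv horb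
    have htT : t ≤ 2 * T := by linarith [ht.2, h.1]
    refine ⟨⟨hν, ht.1, Or.inl ⟨T, u', h, htT⟩⟩, ?_⟩
    rw [hΦ.eq_transmission ν hc T u' h t ⟨ht.1, htT⟩, heq t ht, transmission,
      if_pos (ht.2.trans_lt haT)]
  · have hcl : IsClassicalSolution V ν (Icc 0 a) u :=
      (isClassicalSolution_iff_orbit hV).2 ⟨v, hu, hv, horb⟩
    exact ⟨⟨hν, ht.1, Or.inr ⟨hc, u, (isClassicalSolution_iff_orbit hV).2
      ⟨v, hu, hv, horb.mono (Icc_subset_Icc_right ht.2)⟩⟩⟩,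
      hΦ.eq_classical ν hν hc a u hcl t ht⟩

/-- The extended flow near a collision-free trajectory. -/
theorem IsExtendedFlow.eventually_near_classical (hV : ContDiffOn ℝ ∞ V (Ioi 0))
    {Φ : Plane × Plane → ℝ → Plane} (hΦ : IsExtendedFlow V R Φ) {ν₀ : Plane × Plane}
    {τ : ℝ} (hτ : 0 ≤ τ) {u : ℝ → Plane} (h : IsClassicalSolution V ν₀ (Icc 0 τ) u) {δ : ℝ}
    (hδ : 0 < δ) :
    ∃ η > 0, ∀ᶠ ν in 𝓝 ν₀, ν ∈ ballData R → ∀ t ∈ Icc 0 (τ + η),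
      (ν, t) ∈ flowDomain V R ∧ dist (Φ ν t) (u (min t τ)) < δ := by
  obtain ⟨v, hu, hv, horb⟩ := (isClassicalSolution_iff_orbit hV).1 h
  obtain ⟨η, hη, hev⟩ := horb.exists_nearby (contDiffOn_centralCoeff hV) hτ hδ
  rw [hu, hv] at hev
  have hc : Tendsto (fun ν : Plane × Plane => ((0 : ℝ), ν)) (𝓝 ν₀) (𝓝 (0, ν₀)) :=
    (Continuous.prodMk_right (0 : ℝ)).continuousAt
  refine ⟨η, hη, (hc.eventually hev).mono fun ν hν hball t ht => ?_⟩
  obtain ⟨u', v', hu', hv', horb', hd⟩ := hν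
  obtain ⟨h1, h2⟩ := hΦ.eq_of_orbit hV hball hu' hv' horb' ht
  exact ⟨h1, by rw [h2]; exact (hd t ht).1⟩

/-- The extended flow near a transmission solution. -/
theorem IsExtendedFlow.eventually_near_transmission (hV : ClassVStar V)
    {Φ : Plane × Plane → ℝ → Plane} (hΦ : IsExtendedFlow V R Φ) {ν₀ : Plane × Plane}
    {T : ℝ} {u : ℝ → Plane} (h : CollidesAt V ν₀ T u) {δ : ℝ} (hδ : 0 < δ) :
    ∃ η > 0, ∀ᶠ ν in 𝓝 ν₀, ν ∈ ballData R →
      (∀ t ∈ Icc 0 (2 * (T - δ)), (ν, t) ∈ flowDomain V R) ∧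
      ∀ t ≤ 2 * T + η, (ν, t) ∈ flowDomain V R →
        dist (Φ ν t) (stoppedPath T u t - stoppedPath T u (2 * T - t)) < δ := by
  obtain ⟨v, hu, hv, horb⟩ := h.exists_orbit hV.smooth
  obtain ⟨η, hη, hev⟩ := hV.eventually_near_transmission h.1 horb h.2.2 hδ
  rw [hu, hv] at hev
  have hc : Tendsto (fun ν : Plane × Plane => ((0 : ℝ), ν)) (𝓝 ν₀) (𝓝 (0, ν₀)) :=
    (Continuous.prodMk_right (0 : ℝ)).continuousAt
  refine ⟨η, hη, (hc.eventually hev).mono fun ν hν hball => ?_⟩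
  by_cases hℓ : angMom ν.1 ν.2 = 0
  · obtain ⟨τ, u', v', hτ, hτT, hu', hv', horb', hlim, hd⟩ := hν.2 rfl hℓ
    have hcol : CollidesAt V ν τ u' :=
      ⟨hτ, (isClassicalSolution_iff_orbit hV.smooth).2 ⟨v', hu', hv', horb'⟩, hlim⟩
    have hmem : ν ∈ collisionData V R := ⟨hball, τ, u', hcol⟩
    have hτT' := abs_lt.1 hτT
    refine ⟨fun t ht => ⟨hball, ht.1, Or.inl ⟨τ, u', hcol, by linarith [ht.2]⟩⟩,
      fun t _ htd => ?_⟩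
    have htτ : t ∈ Icc 0 (2 * τ) := by
      refine ⟨htd.2.1, ?_⟩
      rcases htd.2.2 with ⟨T', u'', hcol', hle⟩ | ⟨hno, -⟩
      · rw [(hcol.unique hV.smooth hcol').1] at hle
        exact hle
      · exact absurd hmem hno
    rw [hΦ.eq_transmission ν hmem τ u' hcol t htτ]
    exact hd t htτ
  · obtain ⟨u', v', hu', hv', horb', hd⟩ := hν.1 (Or.inr hℓ)
    refine ⟨fun t ht => (hΦ.eq_of_orbit hV.smooth hball hu' hv' horb'
      ⟨ht.1, by linarith [ht.2]⟩).1, fun t ht htd => ?_⟩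
    have ht' : t ∈ Icc 0 (2 * T + η) := ⟨htd.2.1, ht⟩
    rw [(hΦ.eq_of_orbit hV.smooth hball hu' hv' horb' ht').2]
    exact hd t ht'

theorem ClassVStar.isRegularizedLimit (hV : ClassVStar V) {ν₀ : Plane × Plane} {T : ℝ}
    {u : ℝ → Plane} (h : CollidesAt V ν₀ T u) :
    IsRegularizedLimit V ν₀ (2 * T) (transmission T u) := by
  intro δ hδ
  obtain ⟨v, hu, hv, horb⟩ := h.exists_orbit hV.smooth
  obtain ⟨η, hη, hev⟩ := hV.eventually_near_transmission h.1 horb h.2.2 hδ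
  rw [hu, hv, nhds_prod_eq] at hev
  filter_upwards [hev.filter_mono (prod_mono nhdsWithin_le_nhds le_rfl),
    prod_mem_prod self_mem_nhdsWithin univ_mem] with p hp hp0
  have hε : 0 < p.1 := hp0.1
  obtain ⟨u', v', hu', hv', horb', hd⟩ := hp.1 (Or.inl hε.ne')
  have hsub : Icc 0 (2 * T) ⊆ Icc 0 (2 * T + η) := Icc_subset_Icc_right (by linarith)
  refine ⟨⟨u', (isRegularizedSolution_iff_orbit hV.smooth hε).2
    ⟨v', hu', hv', horb'.mono hsub⟩⟩, fun w hw t ht => ?_⟩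
  obtain ⟨v'', hw0, hv'', horb''⟩ := (isRegularizedSolution_iff_orbit hV.smooth hε).1 hw
  rw [(horb''.unique (contDiffOn_centralCoeff hV.smooth) (horb'.mono hsub) (hw0.trans hu'.symm)
    (hv''.trans hv'.symm) t ht).1, transmission_eq ht]
  exact hd t (hsub ht)

theorem IsExtendedFlow.flowDomain_mem_nhdsWithin (hV : ClassVStar V)
    {Φ : Plane × Plane → ℝ → Plane} (hΦ : IsExtendedFlow V R Φ) {ν₀ : Plane × Plane} {t₀ s : ℝ}
    (hts : t₀ < s) (h : (ν₀, s) ∈ flowDomain V R) :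
    flowDomain V R ∈ 𝓝[ballData R ×ˢ Ici 0] (ν₀, t₀) := by
  obtain ⟨-, hs, ⟨T, u, hcol, hsT⟩ | ⟨-, u, hcl⟩⟩ := h
  -- With this `δ` the time `2 (T - δ) = T + t₀ / 2` still exceeds `t₀`.
  · have hδ : 0 < (2 * T - t₀) / 4 := by
      have : s ≤ 2 * T := hsT
      linarith
    obtain ⟨η, hη, hev⟩ := hΦ.eventually_near_transmission hV hcol hδ
    have h1 : ∀ᶠ z in 𝓝 (ν₀, t₀), z.2 < 2 * (T - (2 * T - t₀) / 4) :=
      continuous_snd.continuousAt.eventually_lt continuousAt_const (by dsimp only; linarith)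
    filter_upwards [self_mem_nhdsWithin, nhdsWithin_le_nhds h1,
      nhdsWithin_le_nhds (continuous_fst.continuousAt.eventually hev)] with z hz hz1 hz2
    exact (hz2 hz.1).1 z.2 ⟨hz.2, hz1.le⟩
  · obtain ⟨η, hη, hev⟩ := hΦ.eventually_near_classical hV.smooth hs hcl one_pos
    have h1 : ∀ᶠ z in 𝓝 (ν₀, t₀), z.2 < s :=
      continuous_snd.continuousAt.eventually_lt continuousAt_const hts
    filter_upwards [self_mem_nhdsWithin, nhdsWithin_le_nhds h1,
      nhdsWithin_le_nhds (continuous_fst.continuousAt.eventually hev)] with z hz hz1 hz2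
    exact (hz2 hz.1 z.2 ⟨hz.2, by linarith⟩).1

theorem IsExtendedFlow.continuousOn (hV : ClassVStar V) {Φ : Plane × Plane → ℝ → Plane}
    (hΦ : IsExtendedFlow V R Φ) :
    ContinuousOn (fun z : (Plane × Plane) × ℝ => Φ z.1 z.2) (flowDomain V R) := by
  rintro ⟨ν₀, t₀⟩ hz₀
  rw [ContinuousWithinAt, Metric.tendsto_nhds]
  intro δ hδ
  obtain ⟨hball, ht₀, ⟨T, u, hcol, htT⟩ | ⟨hno, u, hcl⟩⟩ := hz₀
  · simp only at hball ht₀ htT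
    obtain ⟨η, hη, hev⟩ := hΦ.eventually_near_transmission hV hcol (half_pos hδ)
    obtain ⟨v, -, -, horb⟩ := hcol.exists_orbit hV.smooth
    have hz := (uniformContinuous_stoppedPath hcol.1 horb.continuousOn_fst hcol.2.2).continuous
    have hw : Continuous fun t => stoppedPath T u t - stoppedPath T u (2 * T - t) :=
      hz.sub (hz.comp (continuous_const.sub continuous_id))
    have h1 : ∀ᶠ z in 𝓝 (ν₀, t₀), z.2 < 2 * T + η :=
      continuous_snd.continuousAt.eventually_lt continuousAt_const (by dsimp only; linarith)
    have h2 : ∀ᶠ t in 𝓝 t₀, dist (stoppedPath T u t - stoppedPath T u (2 * T - t))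
        (stoppedPath T u t₀ - stoppedPath T u (2 * T - t₀)) < δ / 2 :=
      hw.continuousAt.eventually (Metric.ball_mem_nhds _ (half_pos hδ))
    filter_upwards [self_mem_nhdsWithin, nhdsWithin_le_nhds h1,
      nhdsWithin_le_nhds (continuous_snd.continuousAt.eventually h2),
      nhdsWithin_le_nhds (continuous_fst.continuousAt.eventually hev)] with z hz hz1 hz2 hz3
    have h3 := (hz3 hz.1).2 z.2 hz1.le hz
    have h4 : Φ ν₀ t₀ = stoppedPath T u t₀ - stoppedPath T u (2 * T - t₀) := by
      rw [hΦ.eq_transmission ν₀ ⟨hball, T, u, hcol⟩ T u hcol t₀ ⟨ht₀, htT⟩,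
        transmission_eq ⟨ht₀, htT⟩]
    rw [h4]
    linarith [dist_triangle (Φ z.1 z.2) (stoppedPath T u z.2 - stoppedPath T u (2 * T - z.2))
      (stoppedPath T u t₀ - stoppedPath T u (2 * T - t₀))]
  · simp only at hball ht₀ hno hcl
    obtain ⟨η, hη, hev⟩ := hΦ.eventually_near_classical hV.smooth ht₀ hcl (half_pos hδ)
    obtain ⟨v, -, -, horb⟩ := (isClassicalSolution_iff_orbit hV.smooth).1 hcl
    have h1 : ∀ᶠ z in 𝓝 (ν₀, t₀), z.2 < t₀ + η :=
      continuous_snd.continuousAt.eventually_lt continuousAt_const (by dsimp only; linarith)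
    obtain ⟨ρ, hρ, hu⟩ := Metric.continuousWithinAt_iff.1
      (horb.continuousOn_fst t₀ (right_mem_Icc.2 ht₀)) (δ / 2) (half_pos hδ)
    have h2 : ∀ᶠ t in 𝓝 t₀, dist t t₀ < ρ := Metric.ball_mem_nhds _ hρ
    filter_upwards [self_mem_nhdsWithin, nhdsWithin_le_nhds h1,
      nhdsWithin_le_nhds (continuous_snd.continuousAt.eventually h2),
      nhdsWithin_le_nhds (continuous_fst.continuousAt.eventually hev)] with z hz hz1 hz2 hz3
    have h3 := (hz3 hz.1 z.2 ⟨hz.2.1, hz1.le⟩).2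
    have h4 : Φ ν₀ t₀ = u t₀ := hΦ.eq_classical ν₀ hball hno t₀ u hcl t₀ (right_mem_Icc.2 ht₀)
    have h5 : dist (u (min z.2 t₀)) (u t₀) < δ / 2 := by
      refine hu ⟨le_min hz.2.1 ht₀, min_le_right _ _⟩ ?_
      rcases le_total z.2 t₀ with h | h
      · rwa [min_eq_left h]
      · rwa [min_eq_right h, dist_self]
    rw [h4]
    linarith [dist_triangle (Φ z.1 z.2) (u (min z.2 t₀)) (u t₀)]

end Main

theorem theorem1 (V : ℝ → ℝ) (hV : ClassVStar V) :
    (∃ R : EReal, IsAdmissibleRadius V R) ∧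
      ∀ R : EReal, IsAdmissibleRadius V R → 0 < R ∧ StronglyRegularizable V R := by
  refine ⟨hV.exists_admissibleRadius, ?_⟩
  rintro R ⟨S, T, hS, hT, -, -, rfl⟩
  have hΦ := isExtendedFlow_extendedFlow (R := min T S) hV.smooth
  exact ⟨lt_min hT hS, fun ν _ T₀ u h => hV.isRegularizedLimit h, _, hΦ,
    fun ν t s _ hts h => hΦ.flowDomain_mem_nhdsWithin hV hts h, hΦ.continuousOn hV⟩
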